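/- Let $P_{11}\subset\mathbb H^3$ be a right-angled ideal polyhedron (a set with nonempty interior that is the convex hull of finitely many points at infinity, any two adjacent faces of which are orthogonal) with a checkerboard coloring of its faces, i.e. each face is black or white and adjacent faces have different colors. Reflecting a polyhedron $P$ across one of its faces $f$ means replacing it by $P\cup\phi_f(P)$, where $\phi_f$ is the reflection in the plane of $f$; a face of a larger polyhedron that contains a face $f'$ of $P$, or $\phi_f(f')$, has it as a subface and inherits the color of $f'$. Let $$P_{11},\,P_{12},\,\dots,\,P_{1k_1}=P_{21},\,\dots,\,P_{2k_2}=P_{31},\,\dots,\,P_{nk_n}=P_{(n+1)1},\,\dots$$ be a sequence of polyhedra, each obtained from the preceding one by reflection across one of its faces ($P_{n(j+1)}$ from $P_{nj}$ across a face $f_{nj}$, $1\le j<k_n$), such that (i) the colors of the faces used alternate along the whole sequence, starting with black; (ii) whenever $P_{nj}$ has a face of the prescribed color that is, or contains as a subface, a face of $P_{n1}$, the face $f_{nj}$ is of this kind; (iii) for every $n$, no face of $P_{n1}$ is a subface of (i.e. is contained in) a face of $P_{nk_n}$. Let $G_{ij}$ be the group generated by the reflections in the faces of $P_{ij}$. Then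 $$\bigcap_{i,j}G_{ij}=\{1\}.$$ Consequently, let $M_{11}=\mathbb H^3/\Gamma$ be a hyperbolic $3$-manifold, where $\Gamma=\pi_1(M_{11})$ is a subgroup of finite index of $G_{11}$ acting freely on $\mathbb H^3$. Then the natural maps $M_{ij}=\mathbb H^3/(\Gamma\cap G_{ij})\to M_{11}$ are covering maps, there is an isomorphism $\pi_1(M_{11})\cong\Gamma$ that takes the image of $\pi_1(M_{ij})$ to $\Gamma\cap G_{ij}$ for all $i,j$, and the family of covers is co-final: the subgroups $\pi_1(M_{ij})=\pi_1(M_{11})\cap G_{ij}$ have finite index in $\pi_1(M_{11})$ and trivial intersection. -/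

import Mathlib

noncomputable section

namespace RAPoly

/-! ### Hyperbolic 3-space (hyperboloid model) -/

/-- The underlying vector space of Minkowski space `ℝ^{1,3}`. -/
abbrev Mink : Type := Fin 4 → ℝ

/-- The Lorentz form of signature `(-,+,+,+)`. -/
def mink (x y : Mink) : ℝ := -(x 0 * y 0) + x 1 * y 1 + x 2 * y 2 + x 3 * y 3

/-- Hyperbolic 3-space: the upper sheet of the hyperboloid `⟨x, x⟩ = -1`. -/
abbrev H3 : Type := {x : Mink // mink x x = -1 ∧ 0 < x 0}

/-- Unit spacelike vectors. Such a vector `e` encodes a hyperplane of hyperbolic space together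
with a choice of one of its two sides. -/
abbrev Spacelike : Type := {e : Mink // mink e e = 1}

/-- The hyperplane `e^⊥`. -/
def wall (e : Spacelike) : Set H3 := {x | mink x.1 e.1 = 0}

/-- The closed half-space bounded by `wall e` for which `e` is the outward normal. -/
def halfSpace (e : Spacelike) : Set H3 := {x | mink x.1 e.1 ≤ 0}

/-- The Lorentz reflection in `e^⊥`. -/
def reflVec (e : Spacelike) (x : Mink) : Mink := x - (2 * mink x e.1) • e.1

theorem reflVec_reflVec (e : Spacelike) (x : Mink) : reflVec e (reflVec e x) = x := by
  obtain ⟨e, he⟩ := e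
  have h : mink (x - (2 * mink x e) • e) e = - mink x e := by
    have : mink (x - (2 * mink x e) • e) e = mink x e - 2 * mink x e * mink e e := by
      simp only [mink, Pi.sub_apply, Pi.smul_apply, smul_eq_mul]; ring
    rw [this, he]; ring
  simp only [reflVec, h]
  ext i
  simp

theorem mink_reflVec_self (e : Spacelike) (x : Mink) :
    mink (reflVec e x) (reflVec e x) = mink x x := by
  obtain ⟨e, he⟩ := e
  have : mink (reflVec ⟨e, he⟩ x) (reflVec ⟨e, he⟩ x)
      = mink x x - 4 * mink x e ^ 2 + 4 * mink x e ^ 2 * mink e e := by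
    simp only [reflVec, mink, Pi.sub_apply, Pi.smul_apply, smul_eq_mul]; ring
  rw [this, he]; ring

theorem reflVec_zero_pos (e : Spacelike) (x : H3) : 0 < reflVec e x.1 0 := by
  obtain ⟨x, hx, hx0⟩ := x
  have hy := mink_reflVec_self e x
  rw [hx] at hy
  have hxy : mink x (reflVec e x) = -1 - 2 * mink x e.1 ^ 2 := by
    have : mink x (reflVec e x) = mink x x - 2 * mink x e.1 ^ 2 := by
      simp only [reflVec, mink, Pi.sub_apply, Pi.smul_apply, smul_eq_mul]; ring
    rw [this, hx]
  change 0 < reflVec e x 0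
  generalize reflVec e x = y at *
  by_contra hneg
  push Not at hneg
  have hlt : mink x y < 0 := by rw [hxy]; nlinarith [sq_nonneg (mink x e.1)]
  simp only [mink] at hx hy hlt
  have h1 : (x 1 * y 1 + x 2 * y 2 + x 3 * y 3) ^ 2
      ≤ (x 1 ^ 2 + x 2 ^ 2 + x 3 ^ 2) * (y 1 ^ 2 + y 2 ^ 2 + y 3 ^ 2) := by
    nlinarith [sq_nonneg (x 1 * y 2 - x 2 * y 1), sq_nonneg (x 1 * y 3 - x 3 * y 1),
      sq_nonneg (x 2 * y 3 - x 3 * y 2)]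
  have h2 : x 1 ^ 2 + x 2 ^ 2 + x 3 ^ 2 = x 0 ^ 2 - 1 := by linarith
  have h3 : y 1 ^ 2 + y 2 ^ 2 + y 3 ^ 2 = y 0 ^ 2 - 1 := by linarith
  rw [h2, h3] at h1
  have h4 : 0 ≤ x 0 * (-y 0) := mul_nonneg hx0.le (by linarith)
  have h5 : x 0 * (-y 0) < -(x 1 * y 1 + x 2 * y 2 + x 3 * y 3) := by linarith
  have h6 : (x 0 * (-y 0)) ^ 2 < (x 1 * y 1 + x 2 * y 2 + x 3 * y 3) ^ 2 := by nlinarith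
  have h7 : 0 ≤ y 1 ^ 2 + y 2 ^ 2 + y 3 ^ 2 := by positivity
  have h8 : 0 ≤ x 1 ^ 2 + x 2 ^ 2 + x 3 ^ 2 := by positivity
  nlinarith

/-- The hyperbolic reflection in the hyperplane `wall e`. -/
def reflection (e : Spacelike) : Equiv.Perm H3 where
  toFun x := ⟨reflVec e x.1, (mink_reflVec_self e x.1).trans x.2.1, reflVec_zero_pos e x⟩
  invFun x := ⟨reflVec e x.1, (mink_reflVec_self e x.1).trans x.2.1, reflVec_zero_pos e x⟩
  left_inv x := Subtype.ext (reflVec_reflVec e x.1)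
  right_inv x := Subtype.ext (reflVec_reflVec e x.1)

/-! ### Right-angled ideal polyhedra -/

/-- `P` is an ideal polyhedron: a set with nonempty interior that is the hyperbolic convex hull of
finitely many points at infinity, the latter being represented by future lightlike vectors. -/
def IsIdealPolyhedron (P : Set H3) : Prop :=
  (interior P).Nonempty ∧
  ∃ S : Finset Mink, (∀ v ∈ S, mink v v = 0 ∧ 0 < v 0) ∧
    ∀ x : H3, x ∈ P ↔ ∃ c : Mink → ℝ, (∀ v ∈ S, 0 ≤ c v) ∧ x.1 = ∑ v ∈ S, c v • v

/-- The part of `P` on the hyperplane `wall e`; it is a face of `P` when `e ∈ faceNormals P`. -/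
def face (P : Set H3) (e : Spacelike) : Set H3 := P ∩ wall e

/-- The outward unit normals of the (two-dimensional) faces of `P`: the supporting half-spaces of
`P` whose bounding plane meets `P` in a set spanning that plane. -/
def faceNormals (P : Set H3) : Set Spacelike :=
  {e | P ⊆ halfSpace e ∧
    Module.finrank ℝ (Submodule.span ℝ ((fun x : H3 => x.1) '' face P e)) = 3}

/-- Two distinct faces are adjacent if they meet inside hyperbolic space. (Ideal polyhedra have no
vertices inside hyperbolic space, so such faces share an edge.) -/
def Adjacent (P : Set H3) (e e' : Spacelike) : Prop :=
  e ≠ e' ∧ (face P e ∩ face P e').Nonempty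

/-- All dihedral angles are `π / 2`. -/
def IsRightAngled (P : Set H3) : Prop :=
  ∀ e ∈ faceNormals P, ∀ e' ∈ faceNormals P, Adjacent P e e' → mink e.1 e'.1 = 0

inductive Color : Type
  | black
  | white

/-- A checkerboard coloring of the faces: adjacent faces have different colors. Only the values
at outward normals of faces of `P` matter. -/
def IsCheckerboard (P : Set H3) (col : Spacelike → Color) : Prop :=
  ∀ e ∈ faceNormals P, ∀ e' ∈ faceNormals P, Adjacent P e e' → col e ≠ col e'

/-- The reflection group of `P`, generated by the reflections in its faces. -/
def reflectionGroup (P : Set H3) : Subgroup (Equiv.Perm H3) :=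
  Subgroup.closure (reflection '' faceNormals P)

/-- The face of `Q` with outward normal `e` is a face of `P` or contains a face of `P` as a
subface. -/
def HasSubface (P Q : Set H3) (e : Spacelike) : Prop :=
  ∃ e₀ ∈ faceNormals P, face P e₀ ⊆ face Q e

/-- The color prescribed for the `m`-th reflection: black and white alternate, black first. -/
def turn (m : ℕ) : Color := if Even m then Color.black else Color.white

/-- The number of reflections performed before stage `i`, if stage `l` performs `k l` of them. -/
def stageStart (k : ℕ → ℕ) (i : ℕ) : ℕ := ∑ l ∈ Finset.range i, k l

/-- A sequence of polyhedra `poly 0, poly 1, …` obtained from a checkerboard colored right-angled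
ideal polyhedron `poly 0` by successive reflections across faces of alternating color, and
subdivided into stages: stage `i` performs `k i` reflections. -/
structure Construction where
  /-- all the polyhedra, in the order in which they are constructed -/
  poly : ℕ → Set H3
  /-- the colors of the faces of `poly m` -/
  color : ℕ → Spacelike → Color
  /-- the outward normal of the face of `poly m` across which `poly m` is reflected -/
  mirror : ℕ → Spacelike
  /-- the number of reflections in each stage -/
  k : ℕ → ℕ
  ideal : IsIdealPolyhedron (poly 0)
  rightAngled : IsRightAngled (poly 0)
  checkerboard : IsCheckerboard (poly 0) (color 0)
  mirror_mem : ∀ m, mirror m ∈ faceNormals (poly m)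
  poly_succ : ∀ m, poly (m + 1) = poly m ∪ reflection (mirror m) '' poly m
  /-- a face of `poly (m + 1)` has the color of its subfaces `f` and `φ(f)`, where `f` is a face
  of `poly m` and `φ` is the `m`-th reflection -/
  color_succ : ∀ m, ∀ e ∈ faceNormals (poly m), ∀ e' ∈ faceNormals (poly (m + 1)),
    face (poly m) e ⊆ face (poly (m + 1)) e' ∨
      reflection (mirror m) '' face (poly m) e ⊆ face (poly (m + 1)) e' →
    color (m + 1) e' = color m e
  /-- the reflections alternate between black and white faces -/
  alternating : ∀ m, color m (mirror m) = turn m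
  /-- during stage `i`, whenever a face of the prescribed color contains a face of the first
  polyhedron of the stage, the reflection is performed across such a face -/
  whenever_possible : ∀ i, ∀ j < k i,
    (∃ e ∈ faceNormals (poly (stageStart k i + j)),
      color (stageStart k i + j) e = turn (stageStart k i + j) ∧
      HasSubface (poly (stageStart k i)) (poly (stageStart k i + j)) e) →
    HasSubface (poly (stageStart k i)) (poly (stageStart k i + j))
      (mirror (stageStart k i + j))
  /-- no face of the first polyhedron of a stage is a subface of the last one -/
  absorbed : ∀ i, ∀ e ∈ faceNormals (poly (stageStart k (i + 1))),
    ¬ HasSubface (poly (stageStart k i)) (poly (stageStart k (i + 1))) e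

namespace Construction

/-- The pairs `(i, j)` with `0 ≤ j ≤ k i`. -/
abbrev Idx (C : Construction) : Type := Σ i : ℕ, Fin (C.k i + 1)

/-- The `j`-th polyhedron of the `i`-th stage (both counted from `0`). The last polyhedron of a
stage is the first one of the next stage. -/
def P (C : Construction) (p : C.Idx) : Set H3 :=
  C.poly (stageStart C.k p.1 + (p.2 : ℕ))

/-- The reflection group of the `j`-th polyhedron of the `i`-th stage. -/
def G (C : Construction) (p : C.Idx) : Subgroup (Equiv.Perm H3) := reflectionGroup (C.P p)

end Construction

/-! ### Quotients of hyperbolic space, covers, co-final families -/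

/-- `Γ` acts freely on hyperbolic space. -/
def ActsFreely (Γ : Subgroup (Equiv.Perm H3)) : Prop :=
  ∀ g ∈ Γ, ∀ x : H3, g x = x → g = 1

/-- The orbit space `H3 / Γ`. -/
abbrev HypQuotient (Γ : Subgroup (Equiv.Perm H3)) : Type := Quotient (MulAction.orbitRel Γ H3)

/-- The image in `H3 / Γ` of a point of hyperbolic space. -/
def proj (Γ : Subgroup (Equiv.Perm H3)) (x : H3) : HypQuotient Γ := Quotient.mk _ x

/-- The natural map `H3 / Γ' → H3 / Γ` for `Γ' ≤ Γ`. -/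
def coverMap {Γ' Γ : Subgroup (Equiv.Perm H3)} (h : Γ' ≤ Γ) :
    C(HypQuotient Γ', HypQuotient Γ) where
  toFun := Quotient.lift (proj Γ) (by
    rintro a b ⟨g, rfl⟩
    exact Quotient.sound ⟨⟨g.1, h g.2⟩, rfl⟩)
  continuous_toFun := continuous_quot_mk.quotient_lift _

/-- The subgroup of `π₁(H3 / Γ)` formed by `π₁(H3 / Γ')`, for the natural map
`H3 / Γ' → H3 / Γ` and the base points given by `x`. -/
def coverPi1 {Γ' Γ : Subgroup (Equiv.Perm H3)} (h : Γ' ≤ Γ) (x : H3) :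
    Subgroup (FundamentalGroup (HypQuotient Γ) (proj Γ x)) :=
  (FundamentalGroup.mapOfEq (coverMap h) (x := proj Γ' x) (y := proj Γ x) rfl).range

/-- A co-final family: finite index subgroups with trivial intersection. -/
def IsCofinal {G ι : Type} [Group G] (H : ι → Subgroup G) : Prop :=
  (∀ i, (H i).FiniteIndex) ∧ (⨅ i, H i) = ⊥

end RAPoly

end

/-!
A right-angled polyhedron `P` is a strict fundamental domain of its reflection group: folding
points across the walls of `P` is confluent, because two walls crossed by the same point are
orthogonal, and the points of `P` are irreducible. Consequently an interior point `x₀` of `P` lies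
on no mirror of the group, and the mirror separating `g x₀` from the translate `g (φ x₀)` in the
chamber across a wall of `g P` is unique.

Doubling `P` across a face gives a right-angled polyhedron with the same interior point `x₀`, whose
reflection group has index at most two. All the `P i` are therefore unions of translates of `P 0`.
If `g x₀ ∈ P i` but `g (φ x₀) ∉ P (i + 1)`, the mirror separating these two points supports a face
of `P i` and a face of `P (i + 1)` containing it, which the absorption of the faces excludes. So
every translate of `x₀` eventually lies in some `P i`; an element `g` of all the reflection groups
moves `x₀` within this fundamental domain of `G i`, whence `g = 1`.
-/

noncomputable section

namespace RAPoly

open Filter Topology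

/-! ### The Lorentz form -/

theorem mink_comm (u v : Mink) : mink u v = mink v u := by simp only [mink]; ring

/-- The linear form `⟨·, e⟩` represented by a vector of Minkowski space. -/
def minkForm (e : Mink) : Mink →ₗ[ℝ] ℝ where
  toFun x := mink x e
  map_add' x y := by simp only [mink, Pi.add_apply]; ring
  map_smul' c x := by simp only [mink, Pi.smul_apply, smul_eq_mul, RingHom.id_apply]; ring

@[simp] theorem minkForm_apply (e x : Mink) : minkForm e x = mink x e := rfl

theorem mink_add_left (u v w : Mink) : mink (u + v) w = mink u w + mink v w :=
  (minkForm w).map_add u v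

theorem mink_sub_left (u v w : Mink) : mink (u - v) w = mink u w - mink v w :=
  (minkForm w).map_sub u v

theorem mink_neg_left (u w : Mink) : mink (-u) w = -mink u w := (minkForm w).map_neg u

theorem mink_smul_left (c : ℝ) (u w : Mink) : mink (c • u) w = c * mink u w :=
  (minkForm w).map_smul c u

theorem mink_add_right (u v w : Mink) : mink w (u + v) = mink w u + mink w v := by
  simp only [mink_comm w, mink_add_left]

theorem mink_sub_right (u v w : Mink) : mink w (u - v) = mink w u - mink w v := by
  simp only [mink_comm w, mink_sub_left]

theorem mink_neg_right (u w : Mink) : mink w (-u) = -mink w u := by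
  simp only [mink_comm w, mink_neg_left]

theorem mink_smul_right (c : ℝ) (u w : Mink) : mink w (c • u) = c * mink w u := by
  simp only [mink_comm w, mink_smul_left]

theorem minkForm_surjective : Function.Surjective minkForm := by
  intro f
  refine ⟨![-f (Pi.single 0 1), f (Pi.single 1 1), f (Pi.single 2 1), f (Pi.single 3 1)], ?_⟩
  refine LinearMap.pi_ext' fun i => LinearMap.ext_ring ?_
  fin_cases i <;> simp [mink]

theorem minkForm_injective : Function.Injective minkForm := by
  intro u v h
  ext i
  have := LinearMap.congr_fun h (Pi.single i 1)
  fin_cases i <;> simpa [mink] using this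

theorem finrank_ker_minkForm {e : Mink} (he : e ≠ 0) :
    Module.finrank ℝ (LinearMap.ker (minkForm e)) = 3 := by
  have hne : minkForm e ≠ 0 := fun h =>
    he (minkForm_injective (h.trans (LinearMap.ext fun x => by simp [mink])))
  have hker := Module.Dual.finrank_ker_add_one_of_ne_zero (f := minkForm e) hne
  have hdim : Module.finrank ℝ Mink = 4 := by simp
  omega

theorem continuous_mink {X : Type*} [TopologicalSpace X] {f g : X → Mink} (hf : Continuous f)
    (hg : Continuous g) : Continuous fun x => mink (f x) (g x) := by
  unfold mink
  fun_prop

theorem spatial_cauchy_schwarz (u v : Mink) : (u 1 * v 1 + u 2 * v 2 + u 3 * v 3) ^ 2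
    ≤ (u 1 ^ 2 + u 2 ^ 2 + u 3 ^ 2) * (v 1 ^ 2 + v 2 ^ 2 + v 3 ^ 2) := by
  nlinarith [sq_nonneg (u 1 * v 2 - u 2 * v 1), sq_nonneg (u 1 * v 3 - u 3 * v 1),
    sq_nonneg (u 2 * v 3 - u 3 * v 2)]

theorem mink_neg_of_timelike_of_causal {u v : Mink} (hu : mink u u < 0) (hu0 : 0 < u 0)
    (hv : mink v v ≤ 0) (hv0 : 0 < v 0) : mink u v < 0 := by
  have hcs := spatial_cauchy_schwarz u v
  simp only [mink] at *
  have hu' : u 1 ^ 2 + u 2 ^ 2 + u 3 ^ 2 < u 0 ^ 2 := by linarith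
  have hv' : v 1 ^ 2 + v 2 ^ 2 + v 3 ^ 2 ≤ v 0 ^ 2 := by linarith
  have hlt : (u 1 * v 1 + u 2 * v 2 + u 3 * v 3) ^ 2 < (u 0 * v 0) ^ 2 := calc
    _ ≤ (u 1 ^ 2 + u 2 ^ 2 + u 3 ^ 2) * (v 1 ^ 2 + v 2 ^ 2 + v 3 ^ 2) := hcs
    _ ≤ (u 1 ^ 2 + u 2 ^ 2 + u 3 ^ 2) * v 0 ^ 2 := by gcongr
    _ < u 0 ^ 2 * v 0 ^ 2 := by gcongr
    _ = (u 0 * v 0) ^ 2 := by ring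
  linarith [lt_of_pow_lt_pow_left₀ 2 (mul_pos hu0 hv0).le hlt]

theorem mink_self_pos_of_orthogonal {u e : Mink} (hu : mink u u < 0) (he : mink u e = 0)
    (hne : e ≠ 0) : 0 < mink e e := by
  have hcs := spatial_cauchy_schwarz u e
  simp only [mink] at *
  have hu' : u 1 ^ 2 + u 2 ^ 2 + u 3 ^ 2 < u 0 ^ 2 := by linarith
  have hu0 : 0 < u 0 ^ 2 := lt_of_le_of_lt (by positivity) hu'
  rw [show u 1 * e 1 + u 2 * e 2 + u 3 * e 3 = u 0 * e 0 by linarith, mul_pow] at hcs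
  have he' : 0 < e 1 ^ 2 + e 2 ^ 2 + e 3 ^ 2 := by
    by_contra! hle
    have h0 : e 0 ^ 2 ≤ 0 := by nlinarith [sq_nonneg (u 1), sq_nonneg (u 2), sq_nonneg (u 3)]
    refine hne (funext fun i => pow_eq_zero_iff two_ne_zero |>.1 (le_antisymm ?_ (sq_nonneg _)))
    fin_cases i <;> simp <;> nlinarith [sq_nonneg (e 1), sq_nonneg (e 2), sq_nonneg (e 3)]
  have : u 0 ^ 2 * e 0 ^ 2 < u 0 ^ 2 * (e 1 ^ 2 + e 2 ^ 2 + e 3 ^ 2) :=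
    hcs.trans_lt (by gcongr)
  linarith [lt_of_mul_lt_mul_left this hu0.le]

theorem mink_self_nonneg_of_orthogonal {u e : Mink} (hu : mink u u < 0) (he : mink u e = 0) :
    0 ≤ mink e e := by
  by_cases h : e = 0
  · simp [h, mink]
  · exact (mink_self_pos_of_orthogonal hu he h).le

theorem mink_sq_le_of_orthogonal {u a b : Mink} (hu : mink u u < 0) (ha : mink u a = 0)
    (hb : mink u b = 0) : mink a b ^ 2 ≤ mink a a * mink b b := by
  have h (t : ℝ) : 0 ≤ mink b b * (t * t) + 2 * mink a b * t + mink a a := by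
    have horth : mink u (a + t • b) = 0 := by
      rw [mink_add_right, mink_smul_right, ha, hb]; ring
    have := mink_self_nonneg_of_orthogonal hu horth
    simp only [mink_add_left, mink_add_right, mink_smul_left, mink_smul_right,
      mink_comm b a] at this
    linarith
  have := discrim_le_zero h
  rw [discrim] at this
  linarith

theorem mink_self_H3_neg (x : H3) : mink x.1 x.1 < 0 := by rw [x.2.1]; norm_num

theorem mink_H3_neg (x y : H3) : mink x.1 y.1 < 0 :=
  mink_neg_of_timelike_of_causal (mink_self_H3_neg x) x.2.2 (mink_self_H3_neg y).le y.2.2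

theorem future_of_mink_neg {v : Mink} {x : H3} (hv : mink v v ≤ 0) (hx : mink v x.1 < 0) :
    0 < v 0 := by
  by_contra! hv0
  have hcs := spatial_cauchy_schwarz v x.1
  have hx' := x.2.1
  have hx0 := x.2.2
  simp only [mink] at *
  have hlt : (v 0 * x.1 0) ^ 2 < (v 1 * x.1 1 + v 2 * x.1 2 + v 3 * x.1 3) ^ 2 :=
    sq_lt_sq.2 (by rw [abs_of_nonpos (by nlinarith), abs_of_neg (by nlinarith)]; linarith)
  have hle : (v 1 ^ 2 + v 2 ^ 2 + v 3 ^ 2) * (x.1 1 ^ 2 + x.1 2 ^ 2 + x.1 3 ^ 2)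
      ≤ v 0 ^ 2 * x.1 0 ^ 2 := by gcongr <;> linarith
  nlinarith

theorem mink_inv_sqrt_smul_self {v : Mink} (hv : mink v v < 0) :
    mink ((√(-mink v v))⁻¹ • v) ((√(-mink v v))⁻¹ • v) = -1 := by
  rw [mink_smul_left, mink_smul_right, ← mul_assoc, ← mul_inv, Real.mul_self_sqrt (neg_pos.2 hv).le,
    inv_neg, neg_mul, inv_mul_cancel₀ hv.ne]

theorem exists_H3_eq_smul {v : Mink} (hv : mink v v < 0) (hv0 : 0 < v 0) :
    ∃ (x : H3) (c : ℝ), 0 < c ∧ x.1 = c • v := by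
  have hc : 0 < (√(-mink v v))⁻¹ := inv_pos.2 (Real.sqrt_pos.2 (neg_pos.2 hv))
  exact ⟨⟨_, mink_inv_sqrt_smul_self hv, by simpa using mul_pos hc hv0⟩, _, hc, rfl⟩

theorem exists_H3_eq_smul_add (x : H3) {v : Mink} (hv : mink v v ≤ 0) (hv0 : 0 < v 0) {t : ℝ}
    (ht : 0 ≤ t) : ∃ (z : H3) (c : ℝ), 0 < c ∧ z.1 = c • (x.1 + t • v) := by
  have hxv := mink_neg_of_timelike_of_causal (mink_self_H3_neg x) x.2.2 hv hv0
  apply exists_H3_eq_smul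
  · simp only [mink_add_left, mink_add_right, mink_smul_left, mink_smul_right, x.2.1,
      mink_comm v x.1]
    nlinarith [mul_nonneg (mul_nonneg ht ht) (neg_nonneg.2 hv),
      mul_nonneg ht (neg_nonneg.2 hxv.le)]
  · exact add_pos_of_pos_of_nonneg x.2.2 (mul_nonneg ht hv0.le)

theorem exists_mem_eq_smul_add {w : H3} {U : Set H3} (hU : U ∈ 𝓝 w) (v : Mink) :
    ∃ z ∈ U, ∃ t > (0 : ℝ), ∃ c > (0 : ℝ), z.1 = c • (w.1 + t • v) := by
  obtain ⟨V, hV, hVU⟩ := mem_nhds_subtype _ _ _ |>.1 hU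
  have hγ : Continuous fun t : ℝ => w.1 + t • v := by fun_prop
  have hnorm : Continuous fun t : ℝ => -mink (w.1 + t • v) (w.1 + t • v) :=
    (continuous_mink hγ hγ).neg
  have htime : ∀ᶠ t in 𝓝 (0 : ℝ), 0 < -mink (w.1 + t • v) (w.1 + t • v) :=
    continuousAt_const.eventually_lt hnorm.continuousAt (by simp [w.2.1])
  have hfut : ∀ᶠ t in 𝓝 (0 : ℝ), 0 < (w.1 + t • v) 0 :=
    continuousAt_const.eventually_lt ((continuous_apply 0).comp hγ).continuousAt
      (by simpa using w.2.2)
  have hmem : ∀ᶠ t in 𝓝 (0 : ℝ),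
      (√(-mink (w.1 + t • v) (w.1 + t • v)))⁻¹ • (w.1 + t • v) ∈ V := by
    refine ContinuousAt.eventually_mem (ContinuousAt.smul (.inv₀ hnorm.sqrt.continuousAt ?_)
      hγ.continuousAt) ?_ <;> simp [w.2.1, hV]
  obtain ⟨t, ⟨ht₁, ht₂, ht₃⟩, ht : 0 < t⟩ := (((htime.and (hfut.and hmem)).filter_mono
    nhdsWithin_le_nhds).and (self_mem_nhdsWithin (s := Set.Ioi (0 : ℝ)))).exists
  have hc : 0 < (√(-mink (w.1 + t • v) (w.1 + t • v)))⁻¹ := inv_pos.2 (Real.sqrt_pos.2 ht₁)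
  exact ⟨⟨_, mink_inv_sqrt_smul_self (neg_pos.1 ht₁), by simpa using mul_pos hc ht₂⟩, hVU ht₃,
    t, ht, _, hc, rfl⟩

theorem Spacelike.ne_zero (e : Spacelike) : e.1 ≠ 0 := by
  intro h
  simpa [h, mink] using e.2

theorem eq_or_eq_neg_of_ker_le {e e' : Spacelike}
    (h : LinearMap.ker (minkForm e.1) ≤ LinearMap.ker (minkForm e'.1)) :
    e'.1 = e.1 ∨ e'.1 = -e.1 := by
  have hv : e'.1 = mink e.1 e'.1 • e.1 := by
    refine minkForm_injective (LinearMap.ext fun x => ?_)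
    have hx : x - mink x e.1 • e.1 ∈ LinearMap.ker (minkForm e.1) := by
      simp [mink_sub_left, mink_smul_left, e.2]
    have := h hx
    simp only [LinearMap.mem_ker, minkForm_apply, mink_sub_left, mink_smul_left] at this
    simp only [minkForm_apply, mink_smul_right]
    linarith
  have hsq : mink e.1 e'.1 ^ 2 = 1 := by
    have := e'.2
    rwa [hv, mink_smul_left, mink_smul_right, e.2, mul_one, ← sq] at this
  rcases sq_eq_one_iff.1 hsq with h | h <;> rw [h] at hv <;> simp [hv]

/-! ### Reflections and isometries -/

theorem mink_reflVec_left (e : Spacelike) (x y : Mink) :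
    mink (reflVec e x) y = mink x y - 2 * mink x e.1 * mink e.1 y := by
  rw [reflVec, mink_sub_left, mink_smul_left]

theorem mink_reflVec_right (e : Spacelike) (x y : Mink) :
    mink x (reflVec e y) = mink x y - 2 * mink x e.1 * mink y e.1 := by
  rw [reflVec, mink_sub_right, mink_smul_right]; ring

theorem mink_reflVec_reflVec (e : Spacelike) (x y : Mink) :
    mink (reflVec e x) (reflVec e y) = mink x y := by
  rw [mink_reflVec_left, mink_reflVec_right, mink_reflVec_right, e.2, mink_comm e.1 y]
  ring

theorem mink_reflVec_comm (e : Spacelike) (x y : Mink) :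
    mink (reflVec e x) y = mink x (reflVec e y) := by
  rw [← mink_reflVec_reflVec e, reflVec_reflVec]

theorem mink_reflVec_self_right (e : Spacelike) (x : Mink) :
    mink (reflVec e x) e.1 = -mink x e.1 := by
  rw [mink_reflVec_left, e.2]; ring

theorem reflVec_eq_self {e : Spacelike} {x : Mink} (h : mink x e.1 = 0) : reflVec e x = x := by
  simp [reflVec, h]

@[simp] theorem reflection_apply (e : Spacelike) (x : H3) : (reflection e x).1 = reflVec e x.1 :=
  rfl

theorem reflection_mul_self (e : Spacelike) : reflection e * reflection e = 1 :=
  Equiv.ext fun x => Subtype.ext (reflVec_reflVec e x.1)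

theorem reflection_reflection (e : Spacelike) (x : H3) : reflection e (reflection e x) = x :=
  Subtype.ext (reflVec_reflVec e x.1)

theorem reflection_inv (e : Spacelike) : (reflection e)⁻¹ = reflection e :=
  inv_eq_of_mul_eq_one_left (reflection_mul_self e)

theorem reflection_eq_self_iff {e : Spacelike} {x : H3} : reflection e x = x ↔ x ∈ wall e := by
  refine ⟨fun h => ?_, fun h => Subtype.ext (reflVec_eq_self h)⟩
  have := mink_reflVec_self_right e x.1
  rw [← reflection_apply, h] at this
  exact self_eq_neg.1 this

theorem reflection_ne_one (e : Spacelike) (x : H3) (hx : x ∈ wall e) : reflection e ≠ 1 := by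
  intro h
  obtain ⟨z, -, t, ht, c, hc, hz⟩ := exists_mem_eq_smul_add (w := x) univ_mem e.1
  have hze : mink z.1 e.1 = 0 := reflection_eq_self_iff.1 (DFunLike.congr_fun h z)
  rw [hz, mink_smul_left, mink_add_left, mink_smul_left, e.2, show mink x.1 e.1 = 0 from hx] at hze
  exact (mul_pos hc ht).ne' (by linarith)

/-- The reflection in `e^⊥` as a linear automorphism of Minkowski space. -/
def reflLin (e : Spacelike) : Mink ≃ₗ[ℝ] Mink :=
  LinearEquiv.ofInvolutive
    { toFun := reflVec e
      map_add' := fun x y => by simp only [reflVec, mink_add_left]; module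
      map_smul' := fun c x => by
        simp only [reflVec, mink_smul_left, RingHom.id_apply]; module }
    (reflVec_reflVec e)

/-- `L` is a Lorentz transformation inducing the permutation `g` of hyperbolic space. -/
def Induces (L : Mink ≃ₗ[ℝ] Mink) (g : Equiv.Perm H3) : Prop :=
  (∀ u v, mink (L u) (L v) = mink u v) ∧ ∀ x, (g x).1 = L x.1

theorem induces_reflLin (e : Spacelike) : Induces (reflLin e) (reflection e) :=
  ⟨mink_reflVec_reflVec e, fun _ => rfl⟩

namespace Induces

variable {L M : Mink ≃ₗ[ℝ] Mink} {g h : Equiv.Perm H3}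

theorem mul (hL : Induces L g) (hM : Induces M h) : Induces (M.trans L) (g * h) :=
  ⟨fun u v => by simp [hL.1, hM.1], fun x => by simp [hL.2, hM.2]⟩

theorem inv (hL : Induces L g) : Induces L.symm g⁻¹ := by
  refine ⟨fun u v => by rw [← hL.1]; simp, fun x => ?_⟩
  rw [LinearEquiv.eq_symm_apply, ← hL.2, Equiv.Perm.coe_inv, Equiv.apply_symm_apply]

theorem mink_symm (hL : Induces L g) (u v : Mink) : mink u (L.symm v) = mink (L u) v := by
  rw [← hL.1, L.apply_symm_apply]

/-- The image of a unit spacelike vector under a Lorentz transformation. -/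
def mapSpacelike (hL : Induces L g) (e : Spacelike) : Spacelike :=
  ⟨L e.1, (hL.1 _ _).trans e.2⟩

theorem mink_mapSpacelike_inv (hL : Induces L g) (x : H3) (e : Spacelike) :
    mink x.1 (hL.inv.mapSpacelike e).1 = mink (g x).1 e.1 := by
  rw [hL.2]; exact hL.mink_symm x.1 e.1

theorem reflection_mapSpacelike (hL : Induces L g) (e : Spacelike) :
    reflection (hL.mapSpacelike e) = g * reflection e * g⁻¹ := by
  ext1 x
  have hx : mink (L.symm x.1) e.1 = mink x.1 (L e.1) := by
    rw [mink_comm, hL.mink_symm, mink_comm]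
  apply Subtype.ext
  simp only [Equiv.Perm.mul_apply, hL.2, reflection_apply, reflVec, map_sub, map_smul, hL.inv.2,
    LinearEquiv.apply_symm_apply, mapSpacelike, hx]

end Induces

/-- The mirror image of the plane `e'^⊥`, with its chosen side, in the plane `e^⊥`. -/
def reflSpacelike (e e' : Spacelike) : Spacelike := (induces_reflLin e).mapSpacelike e'

@[simp] theorem reflSpacelike_val (e e' : Spacelike) : (reflSpacelike e e').1 = reflVec e e'.1 :=
  rfl

theorem reflection_reflSpacelike (e e' : Spacelike) :
    reflection (reflSpacelike e e') = reflection e * reflection e' * reflection e := by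
  rw [reflSpacelike, Induces.reflection_mapSpacelike, reflection_inv]

/-- The isometries of hyperbolic space, defined as the permutations induced by Lorentz
transformations. -/
def isometries : Subgroup (Equiv.Perm H3) where
  carrier := {g | ∃ L, Induces L g}
  mul_mem' := fun ⟨_, hL⟩ ⟨_, hM⟩ => ⟨_, hL.mul hM⟩
  one_mem' := ⟨LinearEquiv.refl ℝ Mink, fun _ _ => rfl, fun _ => rfl⟩
  inv_mem' := fun ⟨_, hL⟩ => ⟨_, hL.inv⟩

theorem closure_reflections_le (F : Set Spacelike) :
    Subgroup.closure (reflection '' F) ≤ isometries := by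
  rw [Subgroup.closure_le]
  rintro _ ⟨e, -, rfl⟩
  exact ⟨_, induces_reflLin e⟩

theorem mink_isometry {g : Equiv.Perm H3} (hg : g ∈ isometries) (x y : H3) :
    mink (g x).1 (g y).1 = mink x.1 y.1 := by
  obtain ⟨L, hL⟩ := hg
  rw [hL.2, hL.2, hL.1]

theorem continuous_of_mem_isometries {g : Equiv.Perm H3} (hg : g ∈ isometries) :
    Continuous g := by
  obtain ⟨L, hL⟩ := hg
  refine continuous_induced_rng.2 ?_
  rw [show Subtype.val ∘ g = L ∘ Subtype.val from funext hL.2]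
  exact L.toLinearMap.continuous_of_finiteDimensional.comp continuous_subtype_val

/-! ### Half-spaces and faces -/

theorem isOpen_setOf_forall_mink_neg {F : Set Spacelike} (hF : F.Finite) :
    IsOpen {x : H3 | ∀ e ∈ F, mink x.1 e.1 < 0} := by
  simp only [Set.ofPred_forall]
  exact hF.isOpen_biInter fun e _ =>
    isOpen_lt (continuous_mink continuous_subtype_val continuous_const) continuous_const

theorem mink_neg_of_mem_interior {P : Set H3} {e : Spacelike} (hP : P ⊆ halfSpace e) {x : H3}
    (hx : x ∈ interior P) : mink x.1 e.1 < 0 := by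
  obtain ⟨z, hzP, t, ht, c, hc, hz⟩ := exists_mem_eq_smul_add (mem_interior_iff_mem_nhds.1 hx) e.1
  have hze : mink z.1 e.1 ≤ 0 := hP hzP
  rw [hz, mink_smul_left, mink_add_left, mink_smul_left, e.2] at hze
  linarith [nonpos_of_mul_nonpos_right hze hc]

theorem span_face_le (P : Set H3) (e : Spacelike) :
    Submodule.span ℝ ((fun x : H3 => x.1) '' face P e) ≤ LinearMap.ker (minkForm e.1) := by
  rw [Submodule.span_le]
  rintro _ ⟨x, hx, rfl⟩
  exact hx.2

theorem span_face_eq {P : Set H3} {e : Spacelike} (he : e ∈ faceNormals P) :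
    Submodule.span ℝ ((fun x : H3 => x.1) '' face P e) = LinearMap.ker (minkForm e.1) :=
  Submodule.eq_of_le_of_finrank_eq (span_face_le P e)
    (he.2.trans (finrank_ker_minkForm e.ne_zero).symm)

theorem face_nonempty {P : Set H3} {e : Spacelike} (he : e ∈ faceNormals P) :
    (face P e).Nonempty := by
  by_contra h
  have := he.2
  rw [Set.not_nonempty_iff_eq_empty.1 h, Set.image_empty, Submodule.span_empty, finrank_bot] at this
  omega

theorem eq_of_face_subset_wall {P : Set H3} {x₀ : H3} {e e' : Spacelike} (he : e ∈ faceNormals P)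
    (h : face P e ⊆ wall e') (hx₀ : x₀ ∈ P) (hx₀' : mink x₀.1 e'.1 < 0) : e' = e := by
  have hker : LinearMap.ker (minkForm e.1) ≤ LinearMap.ker (minkForm e'.1) := by
    rw [← span_face_eq he, Submodule.span_le]
    rintro _ ⟨x, hx, rfl⟩
    exact h hx
  refine Subtype.ext ((eq_or_eq_neg_of_ker_le hker).resolve_right fun hneg => ?_)
  have hx₀e : mink x₀.1 e.1 ≤ 0 := he.1 hx₀
  rw [hneg, mink_neg_right] at hx₀'
  linarith

/-- Convexity of a subset of hyperbolic space, tested on midpoints only. -/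
def MidpointConvex (A : Set H3) : Prop :=
  ∀ x ∈ A, ∀ y ∈ A, ∀ z : H3, ∀ c > (0 : ℝ), z.1 = c • (x.1 + y.1) → z ∈ A

theorem exists_forall_mink_neg {F : Set Spacelike} (hF : F.Finite) {A : Set H3} (hA : A.Nonempty)
    (hconv : MidpointConvex A) (hle : ∀ e ∈ F, A ⊆ halfSpace e)
    (hlt : ∀ e ∈ F, ¬ A ⊆ wall e) : ∃ w ∈ A, ∀ e ∈ F, mink w.1 e.1 < 0 := by
  refine Set.Finite.induction_on_subset
    (motive := fun s _ => ∃ w ∈ A, ∀ e ∈ s, mink w.1 e.1 < 0) F hF ?_ ?_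
  · obtain ⟨w, hw⟩ := hA
    exact ⟨w, hw, by simp⟩
  rintro e s he hs - ⟨w, hw, hws⟩
  obtain ⟨x, hx, hxe⟩ := Set.not_subset.1 (hlt e he)
  replace hxe : mink x.1 e.1 < 0 := lt_of_le_of_ne (hle e he hx) hxe
  obtain ⟨z, c, hc, hz⟩ := exists_H3_eq_smul_add w (mink_self_H3_neg x).le x.2.2 zero_le_one
  rw [one_smul] at hz
  have hneg (a : Spacelike) (h : mink w.1 a.1 + mink x.1 a.1 < 0) : mink z.1 a.1 < 0 := by
    rw [hz, mink_smul_left, mink_add_left]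
    exact mul_neg_of_pos_of_neg hc h
  refine ⟨z, hconv w hw x hx z c hc hz, ?_⟩
  rintro a (rfl | ha)
  · exact hneg a (add_neg_of_nonpos_of_neg (hle a he hw) hxe)
  · exact hneg a (add_neg_of_neg_of_nonpos (hws a ha) (hle a (hs ha) hx))

theorem midpointConvex_face {F : Set Spacelike} {P : Set H3}
    (hP : ∀ x, x ∈ P ↔ ∀ e ∈ F, mink x.1 e.1 ≤ 0) (e : Spacelike) :
    MidpointConvex (face P e) := by
  rintro x ⟨hxP, hxe : mink x.1 e.1 = 0⟩ y ⟨hyP, hye : mink y.1 e.1 = 0⟩ z c hc hz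
  refine ⟨(hP z).2 fun a ha => ?_, ?_⟩
  · rw [hz, mink_smul_left, mink_add_left]
    exact mul_nonpos_of_nonneg_of_nonpos hc.le
      (add_nonpos ((hP x).1 hxP a ha) ((hP y).1 hyP a ha))
  · simp [wall, hz, mink_smul_left, mink_add_left, hxe, hye]

theorem mem_faceNormals_of_forall_mem {P U : Set H3} {e : Spacelike} (hP : P ⊆ halfSpace e)
    {y : H3} (hy : y ∈ wall e) (hU : U ∈ 𝓝 y) (hUP : U ∩ wall e ⊆ P) : e ∈ faceNormals P := by
  refine ⟨hP, ?_⟩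
  rw [← finrank_ker_minkForm e.ne_zero]
  refine congrArg (fun V : Submodule ℝ Mink => Module.finrank ℝ V)
    (le_antisymm (span_face_le P e) fun v hv => ?_)
  obtain ⟨z, hzU, t, ht, c, hc, hz⟩ := exists_mem_eq_smul_add hU v
  have hve : mink v e.1 = 0 := hv
  have hye : mink y.1 e.1 = 0 := hy
  have hze : z ∈ wall e := by
    simp [wall, hz, mink_smul_left, mink_add_left, hve, hye]
  have hspan {x : H3} (hxU : x ∈ U) (hx : x ∈ wall e) :
      x.1 ∈ Submodule.span ℝ ((fun x : H3 => x.1) '' face P e) :=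
    Submodule.subset_span ⟨x, ⟨hUP ⟨hxU, hx⟩, hx⟩, rfl⟩
  have hveq : v = t⁻¹ • (c⁻¹ • z.1 - y.1) := by
    rw [hz, inv_smul_smul₀ hc.ne', add_sub_cancel_left, inv_smul_smul₀ ht.ne']
  rw [hveq]
  exact Submodule.smul_mem _ _ (Submodule.sub_mem _ (Submodule.smul_mem _ _ (hspan hzU hze))
    (hspan (mem_of_mem_nhds hU) hy))

/-- A finite-sided convex polyhedron in hyperbolic space: a set with nonempty interior that is the
intersection of the half-spaces bounded by the planes of its finitely many faces. -/
structure IsPolyhedron (P : Set H3) : Prop where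
  finite : (faceNormals P).Finite
  mem_iff : ∀ x, x ∈ P ↔ ∀ e ∈ faceNormals P, mink x.1 e.1 ≤ 0
  interior_nonempty : (interior P).Nonempty

/-! ### Right-angled chambers -/

/-- A right-angled chamber: `P` is the intersection of the half-spaces with outward normals in the
finite set `F`, and `x₀` is an interior point of `P`. Two bounding planes are orthogonal or, when
`⟨e, e'⟩ ≤ -1`, disjoint with `P` between them. -/
structure IsChamber (F : Set Spacelike) (P : Set H3) (x₀ : H3) : Prop where
  finite : F.Finite
  mem_iff : ∀ x, x ∈ P ↔ ∀ e ∈ F, mink x.1 e.1 ≤ 0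
  pair : ∀ e ∈ F, ∀ e' ∈ F, e ≠ e' → mink e.1 e'.1 = 0 ∨ mink e.1 e'.1 ≤ -1
  base : ∀ e ∈ F, mink x₀.1 e.1 < 0

namespace IsChamber

variable {F : Set Spacelike} {P : Set H3} {x₀ : H3}

theorem base_mem (h : IsChamber F P x₀) : x₀ ∈ P := (h.mem_iff _).2 fun e he => (h.base e he).le

theorem change_base (h : IsChamber F P x₀) {q : H3} (hq : ∀ e ∈ F, mink q.1 e.1 < 0) :
    IsChamber F P q :=
  { h with base := hq }

theorem mem_nhds (h : IsChamber F P x₀) : P ∈ 𝓝 x₀ :=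
  Filter.mem_of_superset ((isOpen_setOf_forall_mink_neg h.finite).mem_nhds h.base)
    fun x hx => (h.mem_iff x).2 fun e he => (hx e he).le

theorem pair_nonpos (h : IsChamber F P x₀) {e e' : Spacelike} (he : e ∈ F) (he' : e' ∈ F)
    (hne : e ≠ e') : mink e.1 e'.1 ≤ 0 := by
  rcases h.pair e he e' he' hne with h | h <;> linarith

theorem orthogonal_of_mink_pos (h : IsChamber F P x₀) {e e' : Spacelike} (he : e ∈ F)
    (he' : e' ∈ F) (hne : e ≠ e') {y : H3} (hy : 0 < mink y.1 e.1) (hy' : 0 < mink y.1 e'.1) :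
    mink e.1 e'.1 = 0 := by
  refine (h.pair e he e' he' hne).resolve_right fun hc => ?_
  -- Otherwise `e + e'` is causal and future directed, since `x₀` sees it negatively.
  have hcausal : mink (e.1 + e'.1) (e.1 + e'.1) ≤ 0 := by
    simp only [mink_add_left, mink_add_right, e.2, e'.2, mink_comm e'.1 e.1]
    linarith
  have hfuture : 0 < (e.1 + e'.1) 0 := by
    refine future_of_mink_neg (x := x₀) hcausal ?_
    rw [mink_add_left, mink_comm e.1, mink_comm e'.1]
    exact add_neg (h.base e he) (h.base e' he')
  have := mink_neg_of_timelike_of_causal (mink_self_H3_neg y) y.2.2 hcausal hfuture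
  rw [mink_add_right] at this
  linarith

/-- One folding step: a point outside a half-space with normal in `F` is reflected into it. -/
def Fold (F : Set Spacelike) (y z : H3) : Prop :=
  ∃ e ∈ F, 0 < mink y.1 e.1 ∧ z = reflection e y

theorem fold_diamond (h : IsChamber F P x₀) (a b c : H3) (hab : Fold F a b) (hac : Fold F a c) :
    ∃ d, Relation.ReflGen (Fold F) b d ∧ Relation.ReflTransGen (Fold F) c d := by
  obtain ⟨e, he, hae, rfl⟩ := hab
  obtain ⟨e', he', hae', rfl⟩ := hac
  by_cases hne : e = e'
  · subst hne
    exact ⟨_, .refl, .refl⟩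
  have ho := h.orthogonal_of_mink_pos he he' hne hae hae'
  have ho' : mink e'.1 e.1 = 0 := by rw [mink_comm, ho]
  refine ⟨reflection e' (reflection e a), .single ⟨e', he', ?_, rfl⟩,
    .single ⟨e, he, ?_, Subtype.ext ?_⟩⟩
  · rw [reflection_apply, mink_reflVec_left, ho]; linarith
  · rw [reflection_apply, mink_reflVec_left, ho']; linarith
  · simp only [reflection_apply, reflVec, mink_sub_left, mink_smul_left, ho, ho']
    module

theorem join_reflection {e : Spacelike} (he : e ∈ F) (y : H3) :
    Relation.Join (Relation.ReflTransGen (Fold F)) y (reflection e y) := by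
  rcases lt_trichotomy (mink y.1 e.1) 0 with hy | hy | hy
  · refine ⟨y, .refl, .single ⟨e, he, ?_, (reflection_reflection e y).symm⟩⟩
    rw [reflection_apply, mink_reflVec_self_right]
    exact neg_pos.2 hy
  · rw [reflection_eq_self_iff.2 hy]
    exact ⟨y, .refl, .refl⟩
  · exact ⟨_, .single ⟨e, he, hy, rfl⟩, .refl⟩

theorem join_apply (h : IsChamber F P x₀) {g : Equiv.Perm H3}
    (hg : g ∈ Subgroup.closure (reflection '' F)) (y : H3) :
    Relation.Join (Relation.ReflTransGen (Fold F)) y (g y) := by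
  have heq := Relation.equivalence_join_reflTransGen h.fold_diamond
  induction hg using Subgroup.closure_induction generalizing y with
  | mem g hg =>
    obtain ⟨e, he, rfl⟩ := hg
    exact join_reflection he y
  | one => exact heq.refl y
  | mul a b _ _ ha hb => exact heq.trans (hb y) (ha (b y))
  | inv a _ ha => simpa using heq.symm (ha (a⁻¹ y))

/-- A chamber is a strict fundamental domain: its points are irreducible for the confluent
relation `Fold`, and points of the same orbit have a common reduct. -/
theorem apply_eq_self (h : IsChamber F P x₀) {g : Equiv.Perm H3}
    (hg : g ∈ Subgroup.closure (reflection '' F)) {x : H3} (hx : x ∈ P) (hgx : g x ∈ P) :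
    g x = x := by
  have hirred {y z : H3} (hy : y ∈ P) (hyz : Relation.ReflTransGen (Fold F) y z) : z = y := by
    rcases hyz.cases_head with rfl | ⟨w, ⟨e, he, hye, -⟩, -⟩
    · rfl
    · exact absurd ((h.mem_iff y).1 hy e he) hye.not_ge
  obtain ⟨z, hxz, hgxz⟩ := h.join_apply hg x
  rw [← hirred hgx hgxz, hirred hx hxz]

theorem eq_one_of_apply_mem (h : IsChamber F P x₀) {g : Equiv.Perm H3}
    (hg : g ∈ Subgroup.closure (reflection '' F)) (hgx : g x₀ ∈ P) : g = 1 := by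
  have hfix := h.apply_eq_self hg h.base_mem hgx
  have hiso := closure_reflections_le F hg
  have hP : P ∩ g ⁻¹' P ∈ 𝓝 x₀ :=
    Filter.inter_mem h.mem_nhds
      ((continuous_of_mem_isometries hiso).continuousAt.preimage_mem_nhds
        (by rw [hfix]; exact h.mem_nhds))
  obtain ⟨L, hL⟩ := hiso
  have hLx : L x₀.1 = x₀.1 := by rw [← hL.2, hfix]
  refine Equiv.ext fun y => Subtype.ext ?_
  obtain ⟨z, ⟨hzP, hgzP⟩, t, ht, c, hc, hz⟩ := exists_mem_eq_smul_add hP y.1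
  have hLz : L z.1 = z.1 := by rw [← hL.2, h.apply_eq_self hg hzP hgzP]
  rw [hz, map_smul, map_add, map_smul, hLx] at hLz
  rw [hL.2, Equiv.Perm.one_apply]
  exact smul_right_injective _ ht.ne' (add_left_cancel (smul_right_injective _ hc.ne' hLz))

theorem exists_face_interior (h : IsChamber F P x₀) {e : Spacelike} (he : e ∈ F) :
    ∃ y : H3, y ∈ wall e ∧ ∀ a ∈ F \ {e}, mink y.1 a.1 < 0 := by
  have hself : mink (x₀.1 - mink x₀.1 e.1 • e.1) (x₀.1 - mink x₀.1 e.1 • e.1) < 0 := by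
    simp only [mink_sub_left, mink_sub_right, mink_smul_left, mink_smul_right, e.2, x₀.2.1,
      mink_comm e.1]
    nlinarith [sq_nonneg (mink x₀.1 e.1)]
  have hx₀ : mink (x₀.1 - mink x₀.1 e.1 • e.1) x₀.1 < 0 := by
    rw [mink_sub_left, mink_smul_left, x₀.2.1, mink_comm e.1]
    nlinarith [sq_nonneg (mink x₀.1 e.1)]
  obtain ⟨y, c, hc, hy⟩ := exists_H3_eq_smul hself (future_of_mink_neg hself.le hx₀)
  refine ⟨y, ?_, fun a ha => ?_⟩
  · simp [wall, hy, mink_sub_left, mink_smul_left, e.2]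
  · rw [hy, mink_smul_left, mink_sub_left, mink_smul_left]
    have := mul_nonneg_of_nonpos_of_nonpos (h.base e he).le (h.pair_nonpos he ha.1 (Ne.symm ha.2))
    exact mul_neg_of_pos_of_neg hc (by linarith [h.base a ha.1])

theorem subset_faceNormals (h : IsChamber F P x₀) : F ⊆ faceNormals P := by
  intro e he
  obtain ⟨y, hye, hy⟩ := h.exists_face_interior he
  refine mem_faceNormals_of_forall_mem (fun x hx => (h.mem_iff x).1 hx e he) hye
    ((isOpen_setOf_forall_mink_neg (h.finite.subset Set.sdiff_subset)).mem_nhds hy) ?_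
  rintro z ⟨hz, hze⟩
  refine (h.mem_iff z).2 fun a ha => ?_
  by_cases hae : a = e
  · exact hae ▸ le_of_eq hze
  · exact (hz a ⟨ha, hae⟩).le

theorem faceNormals_eq (h : IsChamber F P x₀) : faceNormals P = F := by
  refine Set.Subset.antisymm (fun e he => ?_) h.subset_faceNormals
  by_contra heF
  obtain ⟨w, hw, hwF⟩ := exists_forall_mink_neg h.finite (face_nonempty he)
    (midpointConvex_face h.mem_iff e) (fun a ha x hx => (h.mem_iff x).1 hx.1 a ha)
    (fun a ha hsub => heF (eq_of_face_subset_wall he hsub h.base_mem (h.base a ha) ▸ ha))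
  have hwP : w ∈ interior P := mem_interior_iff_mem_nhds.2 (h.change_base hwF).mem_nhds
  exact (mink_neg_of_mem_interior he.1 hwP).ne hw.2

/-! ### Mirrors of the reflection group -/

theorem mink_ne_zero_of_mirror (h : IsChamber F P x₀) {ρ : Spacelike}
    (hρ : reflection ρ ∈ Subgroup.closure (reflection '' F)) : mink x₀.1 ρ.1 ≠ 0 := fun h0 =>
  reflection_ne_one ρ x₀ h0
    (h.eq_one_of_apply_mem hρ (by rw [reflection_eq_self_iff.2 h0]; exact h.base_mem))

theorem mink_mul_nonneg_of_mirror (h : IsChamber F P x₀) {ρ : Spacelike}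
    (hρ : reflection ρ ∈ Subgroup.closure (reflection '' F)) {x : H3} (hx : x ∈ P) :
    0 ≤ mink x₀.1 ρ.1 * mink x.1 ρ.1 := by
  by_contra! hneg
  have hx0 : mink x.1 ρ.1 ≠ 0 := fun h0 => by simp [h0] at hneg
  have ht : 0 ≤ -mink x₀.1 ρ.1 / mink x.1 ρ.1 := by
    rw [neg_div, neg_nonneg]
    exact (div_neg_iff.2 (mul_neg_iff.1 hneg)).le
  -- The segment from `x₀` to `x` meets the mirror at `z`, in the interior of the chamber.
  obtain ⟨z, c, hc, hz⟩ := exists_H3_eq_smul_add x₀ (mink_self_H3_neg x).le x.2.2 ht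
  have hzF : ∀ e ∈ F, mink z.1 e.1 < 0 := fun e he => by
    rw [hz, mink_smul_left, mink_add_left, mink_smul_left]
    exact mul_neg_of_pos_of_neg hc (add_neg_of_neg_of_nonpos (h.base e he)
      (mul_nonpos_of_nonneg_of_nonpos ht ((h.mem_iff x).1 hx e he)))
  refine (h.change_base hzF).mink_ne_zero_of_mirror hρ ?_
  rw [hz, mink_smul_left, mink_add_left, mink_smul_left, div_mul_cancel₀ _ hx0, add_neg_cancel,
    mul_zero]

theorem eq_of_mirror_separates (h : IsChamber F P x₀) {ρ e : Spacelike}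
    (hρ : reflection ρ ∈ Subgroup.closure (reflection '' F)) (he : e ∈ F)
    (hx₀ : mink x₀.1 ρ.1 ≤ 0) (hex₀ : 0 < mink (reflection e x₀).1 ρ.1) : ρ = e := by
  have hlt : mink x₀.1 ρ.1 < 0 := lt_of_le_of_ne hx₀ (h.mink_ne_zero_of_mirror hρ)
  refine eq_of_face_subset_wall (h.subset_faceNormals he) ?_ h.base_mem hlt
  -- The chamber lies on one side of the mirror `ρ` and on the other side of its image under the
  -- reflection in `e`, and both mirrors meet the wall `e` in the same set.
  rintro p ⟨hp, hpe : mink p.1 e.1 = 0⟩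
  have he' : reflection e ∈ Subgroup.closure (reflection '' F) :=
    Subgroup.subset_closure ⟨e, he, rfl⟩
  have hρ' : reflection (reflSpacelike e ρ) ∈ Subgroup.closure (reflection '' F) := by
    rw [reflection_reflSpacelike]
    exact mul_mem (mul_mem he' hρ) he'
  have hle := h.mink_mul_nonneg_of_mirror hρ hp
  have hge := h.mink_mul_nonneg_of_mirror hρ' hp
  rw [reflSpacelike_val, ← mink_reflVec_comm, ← mink_reflVec_comm, ← reflection_apply,
    reflVec_eq_self hpe] at hge
  exact le_antisymm (nonpos_of_mul_nonneg_right hle hlt) (nonneg_of_mul_nonneg_right hge hex₀)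

theorem eq_mapSpacelike_of_mirror_separates (h : IsChamber F P x₀) {g : Equiv.Perm H3}
    (hg : g ∈ Subgroup.closure (reflection '' F)) {L : Mink ≃ₗ[ℝ] Mink} (hL : Induces L g)
    {ρ e : Spacelike} (hρ : reflection ρ ∈ Subgroup.closure (reflection '' F)) (he : e ∈ F)
    (hgx₀ : mink (g x₀).1 ρ.1 ≤ 0) (hgex₀ : 0 < mink (g (reflection e x₀)).1 ρ.1) :
    ρ = hL.mapSpacelike e := by
  rw [← hL.mink_mapSpacelike_inv] at hgx₀ hgex₀
  have hconj : reflection (hL.inv.mapSpacelike ρ) ∈ Subgroup.closure (reflection '' F) := by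
    rw [Induces.reflection_mapSpacelike]
    exact mul_mem (mul_mem (inv_mem hg) hρ) (inv_mem (inv_mem hg))
  rw [← h.eq_of_mirror_separates hconj he hgx₀ hgex₀]
  exact Subtype.ext (L.apply_symm_apply ρ.1).symm

theorem exists_common_wall (h : IsChamber F P x₀) {Q Q' : Set H3} {E E' : Set Spacelike}
    (hQ : ∀ x, x ∈ Q ↔ ∀ e ∈ E, mink x.1 e.1 ≤ 0) (hQ' : ∀ x, x ∈ Q' ↔ ∀ e ∈ E', mink x.1 e.1 ≤ 0)
    (hE : ∀ e ∈ E, reflection e ∈ Subgroup.closure (reflection '' F))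
    (hE' : ∀ e ∈ E', reflection e ∈ Subgroup.closure (reflection '' F)) (hsub : Q ⊆ Q')
    {g : Equiv.Perm H3} (hg : g ∈ Subgroup.closure (reflection '' F)) {e : Spacelike} (he : e ∈ F)
    (hgx : g x₀ ∈ Q) (hgex : g (reflection e x₀) ∉ Q') : (E ∩ E').Nonempty := by
  obtain ⟨L, hL⟩ := closure_reflections_le F hg
  have hgexQ : g (reflection e x₀) ∉ Q := fun hmem => hgex (hsub hmem)
  have hgxQ' : g x₀ ∈ Q' := hsub hgx
  rw [hQ] at hgexQ hgx
  rw [hQ'] at hgex hgxQ'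
  push Not at hgex hgexQ
  obtain ⟨a, ha, hgea⟩ := hgexQ
  obtain ⟨b, hb, hgeb⟩ := hgex
  have hab : a = b :=
    (h.eq_mapSpacelike_of_mirror_separates hg hL (hE a ha) he (hgx a ha) hgea).trans
      (h.eq_mapSpacelike_of_mirror_separates hg hL (hE' b hb) he (hgxQ' b hb) hgeb).symm
  exact ⟨a, ha, hab ▸ hb⟩

end IsChamber

/-! ### Doubling a chamber across a wall -/

/-- The outward normals of the union of a chamber and its mirror image in the wall `e`. -/
def doubleNormals (F : Set Spacelike) (e : Spacelike) : Set Spacelike :=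
  (F \ {e}) ∪ reflSpacelike e '' (F \ {e})

/-- `Q` is obtained from `P` by reflection across one of its faces. -/
def IsDouble (P Q : Set H3) : Prop := ∃ e ∈ faceNormals P, Q = P ∪ reflection e '' P

namespace IsChamber

variable {F : Set Spacelike} {P : Set H3} {x₀ : H3} {e : Spacelike}

theorem mem_iff_forall_sdiff (h : IsChamber F P x₀) {x : H3} (hx : mink x.1 e.1 ≤ 0) :
    x ∈ P ↔ ∀ a ∈ F \ {e}, mink x.1 a.1 ≤ 0 := by
  rw [h.mem_iff]
  refine ⟨fun hF a ha => hF a ha.1, fun hF a ha => ?_⟩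
  by_cases hae : a = e
  · rwa [hae]
  · exact hF a ⟨ha, hae⟩

theorem mink_reflSpacelike_le (h : IsChamber F P x₀) (he : e ∈ F) {x : H3} (hx : x ∈ P)
    {a : Spacelike} (ha : a ∈ F \ {e}) : mink x.1 (reflSpacelike e a).1 ≤ mink x.1 a.1 := by
  rw [reflSpacelike_val, mink_reflVec_right]
  have := mul_nonneg_of_nonpos_of_nonpos ((h.mem_iff x).1 hx e he) (h.pair_nonpos ha.1 he ha.2)
  linarith

theorem mem_double_iff (h : IsChamber F P x₀) (he : e ∈ F) (x : H3) :
    x ∈ P ∪ reflection e '' P ↔ ∀ a ∈ doubleNormals F e, mink x.1 a.1 ≤ 0 := by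
  constructor
  · rintro (hx | ⟨y, hy, rfl⟩) _ (ha | ⟨a, ha, rfl⟩)
    · exact (h.mem_iff x).1 hx _ ha.1
    · exact (h.mink_reflSpacelike_le he hx ha).trans ((h.mem_iff x).1 hx a ha.1)
    · rw [reflection_apply, mink_reflVec_comm, ← reflSpacelike_val]
      exact (h.mink_reflSpacelike_le he hy ha).trans ((h.mem_iff y).1 hy _ ha.1)
    · rw [reflection_apply, reflSpacelike_val, mink_reflVec_reflVec]
      exact (h.mem_iff y).1 hy a ha.1
  · intro hx
    rcases le_total (mink x.1 e.1) 0 with hxe | hxe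
    · exact Or.inl ((h.mem_iff_forall_sdiff hxe).2 fun a ha => hx a (Or.inl ha))
    · have hex : mink (reflection e x).1 e.1 ≤ 0 := by
        rw [reflection_apply, mink_reflVec_self_right]
        exact neg_nonpos.2 hxe
      refine Or.inr ⟨_, (h.mem_iff_forall_sdiff hex).2 fun a ha => ?_, reflection_reflection e x⟩
      rw [reflection_apply, mink_reflVec_comm]
      exact hx _ (Or.inr ⟨a, ha, rfl⟩)

theorem pair_reflSpacelike (h : IsChamber F P x₀) (he : e ∈ F) {a b : Spacelike}
    (ha : a ∈ F \ {e}) (hb : b ∈ F \ {e}) (hne : a ≠ reflSpacelike e b) :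
    mink a.1 (reflSpacelike e b).1 = 0 ∨ mink a.1 (reflSpacelike e b).1 ≤ -1 := by
  rw [reflSpacelike_val, mink_reflVec_right]
  rcases h.pair a ha.1 e he ha.2 with hae | hae
  · have hab : a ≠ b := fun hab =>
      hne (Subtype.ext (by rw [← hab, reflSpacelike_val, reflVec_eq_self hae]))
    simpa [hae] using h.pair a ha.1 b hb.1 hab
  by_cases hab : a = b
  · right
    rw [← hab, a.2]
    nlinarith
  rcases h.pair b hb.1 e he hb.2 with hbe | hbe
  · simpa [hbe] using h.pair a ha.1 b hb.1 hab
  · right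
    nlinarith [h.pair_nonpos ha.1 hb.1 hab]

theorem double (h : IsChamber F P x₀) (he : e ∈ F) :
    IsChamber (doubleNormals F e) (P ∪ reflection e '' P) x₀ where
  finite := (h.finite.subset Set.sdiff_subset).union ((h.finite.subset Set.sdiff_subset).image _)
  mem_iff := h.mem_double_iff he
  pair := by
    rintro a (ha | ⟨a, ha, rfl⟩) b (hb | ⟨b, hb, rfl⟩) hne
    · exact h.pair a ha.1 b hb.1 hne
    · exact h.pair_reflSpacelike he ha hb hne
    · rw [mink_comm]
      exact h.pair_reflSpacelike he hb ha hne.symm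
    · rw [reflSpacelike_val, reflSpacelike_val, mink_reflVec_reflVec]
      exact h.pair a ha.1 b hb.1 fun hab => hne (by rw [hab])
  base := by
    rintro _ (ha | ⟨a, ha, rfl⟩)
    · exact h.base _ ha.1
    · exact (h.mink_reflSpacelike_le he h.base_mem ha).trans_lt (h.base a ha.1)

end IsChamber

theorem closure_doubleNormals_le {F : Set Spacelike} {e : Spacelike} (he : e ∈ F) :
    Subgroup.closure (reflection '' doubleNormals F e) ≤ Subgroup.closure (reflection '' F) := by
  rw [Subgroup.closure_le]
  have hF {a : Spacelike} (ha : a ∈ F) : reflection a ∈ Subgroup.closure (reflection '' F) :=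
    Subgroup.subset_closure ⟨a, ha, rfl⟩
  rintro _ ⟨b, hb | ⟨a, ha, rfl⟩, rfl⟩
  · exact hF hb.1
  · rw [reflection_reflSpacelike]
    exact mul_mem (mul_mem (hF he) (hF ha.1)) (hF he)

theorem reflection_mul_mem_or {F : Set Spacelike} {H : Subgroup (Equiv.Perm H3)} {e a : Spacelike}
    (hH : reflection '' doubleNormals F e ⊆ H) (ha : a ∈ F) {g : Equiv.Perm H3}
    (hg : g ∈ H ∨ reflection e * g ∈ H) :
    reflection a * g ∈ H ∨ reflection e * (reflection a * g) ∈ H := by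
  by_cases hae : a = e
  · rw [hae, ← mul_assoc, reflection_mul_self, one_mul]
    exact hg.symm
  · have haH : reflection a ∈ H := hH ⟨a, Or.inl ⟨ha, hae⟩, rfl⟩
    have haH' : reflection e * reflection a * reflection e ∈ H :=
      reflection_reflSpacelike e a ▸ hH ⟨_, Or.inr ⟨a, ⟨ha, hae⟩, rfl⟩, rfl⟩
    refine hg.imp (mul_mem haH) fun hg => ?_
    have := mul_mem haH' hg
    rwa [mul_assoc, ← mul_assoc (reflection e) (reflection e), reflection_mul_self, one_mul,
      mul_assoc] at this

theorem mem_closure_doubleNormals_or {F : Set Spacelike} {e : Spacelike} {g : Equiv.Perm H3}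
    (hg : g ∈ Subgroup.closure (reflection '' F)) :
    g ∈ Subgroup.closure (reflection '' doubleNormals F e) ∨
      reflection e * g ∈ Subgroup.closure (reflection '' doubleNormals F e) := by
  induction hg using Subgroup.closure_induction_left with
  | one => exact Or.inl (one_mem _)
  | mul_left y hy g _ ih =>
    obtain ⟨a, ha, rfl⟩ := hy
    exact reflection_mul_mem_or Subgroup.subset_closure ha ih
  | inv_mul_cancel y hy g _ ih =>
    obtain ⟨a, ha, rfl⟩ := hy
    rw [reflection_inv]
    exact reflection_mul_mem_or Subgroup.subset_closure ha ih

theorem relIndex_ne_zero_of_forall_mem_or {G : Type*} [Group G] {H K : Subgroup G} {s : G}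
    (hs : s ∈ K) (h : ∀ g ∈ K, g ∈ H ∨ s * g ∈ H) : H.relIndex K ≠ 0 := by
  let coset (b : Bool) : K ⧸ H.subgroupOf K := if b then ↑(1 : K) else ↑(⟨s, hs⟩⁻¹ : K)
  have hcoset : Function.Surjective coset := by
    intro q
    obtain ⟨g, rfl⟩ := QuotientGroup.mk_surjective q
    rcases h g.1 g.2 with hg | hg
    · exact ⟨true, QuotientGroup.eq.2 (by simpa [Subgroup.mem_subgroupOf] using hg)⟩
    · exact ⟨false, QuotientGroup.eq.2 (by simpa [Subgroup.mem_subgroupOf] using hg)⟩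
  have : Finite (K ⧸ H.subgroupOf K) := Finite.of_surjective coset hcoset
  exact (Subgroup.finiteIndex_of_finite_quotient (H := H.subgroupOf K)).index_ne_zero

/-! ### Iterated doubling -/

section Iterate

variable {P Q : Set H3} {x₀ : H3}

theorem IsDouble.subset (hPQ : IsDouble P Q) : P ⊆ Q := by
  obtain ⟨e, -, rfl⟩ := hPQ
  exact Set.subset_union_left

theorem IsDouble.chamber (hPQ : IsDouble P Q) (h : IsChamber (faceNormals P) P x₀) :
    IsChamber (faceNormals Q) Q x₀ := by
  obtain ⟨e, he, rfl⟩ := hPQ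
  rw [(h.double he).faceNormals_eq]
  exact h.double he

theorem IsDouble.reflectionGroup_le (hPQ : IsDouble P Q) (h : IsChamber (faceNormals P) P x₀) :
    reflectionGroup Q ≤ reflectionGroup P := by
  obtain ⟨e, he, rfl⟩ := hPQ
  rw [reflectionGroup, (h.double he).faceNormals_eq]
  exact closure_doubleNormals_le he

theorem IsDouble.relIndex_ne_zero (hPQ : IsDouble P Q) (h : IsChamber (faceNormals P) P x₀) :
    (reflectionGroup Q).relIndex (reflectionGroup P) ≠ 0 := by
  obtain ⟨e, he, rfl⟩ := hPQ
  rw [reflectionGroup, (h.double he).faceNormals_eq]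
  exact relIndex_ne_zero_of_forall_mem_or (Subgroup.subset_closure ⟨e, he, rfl⟩)
    fun g => mem_closure_doubleNormals_or

namespace IsChamber

theorem iterate (h : IsChamber (faceNormals P) P x₀) (hPQ : Relation.ReflTransGen IsDouble P Q) :
    IsChamber (faceNormals Q) Q x₀ := by
  induction hPQ with
  | refl => exact h
  | tail _ hQR ih => exact hQR.chamber ih

theorem reflectionGroup_le (h : IsChamber (faceNormals P) P x₀)
    (hPQ : Relation.ReflTransGen IsDouble P Q) : reflectionGroup Q ≤ reflectionGroup P := by
  induction hPQ with
  | refl => exact le_rfl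
  | tail hPQ hQR ih => exact (hQR.reflectionGroup_le (h.iterate hPQ)).trans ih

theorem relIndex_ne_zero (h : IsChamber (faceNormals P) P x₀)
    (hPQ : Relation.ReflTransGen IsDouble P Q) :
    (reflectionGroup Q).relIndex (reflectionGroup P) ≠ 0 := by
  induction hPQ with
  | refl => simp
  | tail hPQ hQR ih =>
    exact Subgroup.relIndex_ne_zero_trans (hQR.relIndex_ne_zero (h.iterate hPQ)) ih

theorem apply_reflection_mem (h : IsChamber (faceNormals P) P x₀) {Q' : Set H3}
    (hQ : Relation.ReflTransGen IsDouble P Q) (hQ' : Relation.ReflTransGen IsDouble P Q')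
    (hsub : Q ⊆ Q') (habs : ∀ e ∈ faceNormals Q', ¬ HasSubface Q Q' e)
    {g : Equiv.Perm H3} (hg : g ∈ reflectionGroup P) (hgx : g x₀ ∈ Q) {e : Spacelike}
    (he : e ∈ faceNormals P) : g (reflection e x₀) ∈ Q' := by
  by_contra hcon
  have hmirror {R : Set H3} (hR : Relation.ReflTransGen IsDouble P R) (a) (ha : a ∈ faceNormals R) :
      reflection a ∈ reflectionGroup P :=
    h.reflectionGroup_le hR (Subgroup.subset_closure ⟨a, ha, rfl⟩)
  obtain ⟨ρ, hρ, hρ'⟩ := h.exists_common_wall (h.iterate hQ).mem_iff (h.iterate hQ').mem_iff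
    (hmirror hQ) (hmirror hQ') hsub hg he hgx hcon
  exact habs ρ hρ' ⟨ρ, hρ, Set.inter_subset_inter_left _ hsub⟩

variable {R : ℕ → Set H3}

theorem exists_apply_base_mem (h : IsChamber (faceNormals P) P x₀)
    (hR : ∀ i, Relation.ReflTransGen IsDouble P (R i)) (hmono : Monotone R)
    (habs : ∀ i, ∀ e ∈ faceNormals (R (i + 1)), ¬ HasSubface (R i) (R (i + 1)) e)
    {g : Equiv.Perm H3} (hg : g ∈ reflectionGroup P) : ∃ i, g x₀ ∈ R i := by
  have step {g : Equiv.Perm H3} (hg : g ∈ reflectionGroup P) {e : Spacelike}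
      (he : e ∈ faceNormals P) : (∃ i, g x₀ ∈ R i) → ∃ i, g (reflection e x₀) ∈ R i := by
    rintro ⟨i, hi⟩
    exact ⟨i + 1,
      h.apply_reflection_mem (hR i) (hR (i + 1)) (hmono i.le_succ) (habs i) hg hi he⟩
  rw [reflectionGroup] at hg
  induction hg using Subgroup.closure_induction_right with
  | one => exact ⟨0, (h.iterate (hR 0)).base_mem⟩
  | mul_right g hg y hy ih =>
    obtain ⟨e, he, rfl⟩ := hy
    exact step hg he ih
  | mul_inv_cancel g hg y hy ih =>
    obtain ⟨e, he, rfl⟩ := hy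
    rw [reflection_inv]
    exact step hg he ih

theorem iInf_reflectionGroup_eq_bot (h : IsChamber (faceNormals P) P x₀)
    (hR : ∀ i, Relation.ReflTransGen IsDouble P (R i)) (hmono : Monotone R)
    (habs : ∀ i, ∀ e ∈ faceNormals (R (i + 1)), ¬ HasSubface (R i) (R (i + 1)) e) :
    ⨅ i, reflectionGroup (R i) = ⊥ := by
  refine (Subgroup.eq_bot_iff_forall _).2 fun g hg => ?_
  rw [Subgroup.mem_iInf] at hg
  obtain ⟨i, hi⟩ := h.exists_apply_base_mem hR hmono habs (h.reflectionGroup_le (hR 0) (hg 0))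
  exact (h.iterate (hR i)).eq_one_of_apply_mem (hg i) hi

end IsChamber

end Iterate

/-! ### Facets of finitely generated cones -/

section Cone

variable {V : Type*} [AddCommGroup V] [Module ℝ V] {S : Set V}

theorem mem_hull_finset {S : Finset V} {x : V} : x ∈ PointedCone.hull ℝ (S : Set V) ↔
    ∃ c : V → ℝ, (∀ v ∈ S, 0 ≤ c v) ∧ x = ∑ v ∈ S, c v • v := by
  constructor
  · intro hx
    obtain ⟨c, -, rfl⟩ := Submodule.mem_span_finset.1 hx
    exact ⟨fun v => c v, fun v _ => (c v).2, rfl⟩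
  · rintro ⟨c, hc, rfl⟩
    exact Submodule.sum_mem _ fun v hv =>
      PointedCone.smul_mem _ (hc v hv) (PointedCone.subset_hull hv)

theorem map_nonpos_of_mem_hull {f : V →ₗ[ℝ] ℝ} (hf : ∀ v ∈ S, f v ≤ 0) {x : V}
    (hx : x ∈ PointedCone.hull ℝ S) : f x ≤ 0 := by
  have hle : PointedCone.hull ℝ S ≤ (PointedCone.positive ℝ ℝ).comap (-f) :=
    Submodule.span_le.2 fun v hv => by simpa using hf v hv
  simpa using hle hx

theorem mem_hull_of_map_eq_zero {f : V →ₗ[ℝ] ℝ} (hf : ∀ v ∈ S, f v ≤ 0) {x : V}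
    (hx : x ∈ PointedCone.hull ℝ S) (hfx : f x = 0) :
    x ∈ PointedCone.hull ℝ {v | v ∈ S ∧ f v = 0} := by
  induction hx using Submodule.span_induction with
  | mem v hv => exact PointedCone.subset_hull ⟨hv, hfx⟩
  | zero => exact zero_mem _
  | add a b ha hb iha ihb =>
    have ha' := map_nonpos_of_mem_hull hf ha
    have hb' := map_nonpos_of_mem_hull hf hb
    rw [map_add] at hfx
    exact add_mem (iha (by linarith)) (ihb (by linarith))
  | smul c a _ iha =>
    rcases eq_or_ne c 0 with rfl | hc
    · simp
    · have hca : (c : ℝ) * f a = 0 := (f.map_smul (c : ℝ) a).symm.trans hfx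
      exact Submodule.smul_mem _ c
        (iha ((mul_eq_zero.1 hca).resolve_left (NNReal.coe_ne_zero.2 hc)))

theorem exists_form_nonpos_pos [TopologicalSpace V] [IsTopologicalAddGroup V] [ContinuousSMul ℝ V]
    [LocallyConvexSpace ℝ V] [T2Space V] (hfin : S.Finite) {ℓ : V →ₗ[ℝ] ℝ}
    (hS : ∀ v ∈ S, 0 < ℓ v) {x : V} (hℓx : 0 < ℓ x) (hx : x ∉ PointedCone.hull ℝ S) :
    ∃ f : V →ₗ[ℝ] ℝ, (∀ v ∈ S, f v ≤ 0) ∧ 0 < f x := by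
  -- The affine slice `ℓ = 1` turns the cone into the convex hull of a finite set, which is compact.
  set T : Set V := (fun v => (ℓ v)⁻¹ • v) '' S
  have hTS : convexHull ℝ T ⊆ PointedCone.hull ℝ S := by
    refine convexHull_min ?_ (PointedCone.convex _)
    rintro _ ⟨v, hv, rfl⟩
    exact PointedCone.smul_mem _ (inv_pos.2 (hS v hv)).le (PointedCone.subset_hull hv)
  have hxT : (ℓ x)⁻¹ • x ∉ convexHull ℝ T := fun h => hx <| by
    have hmem := PointedCone.smul_mem (PointedCone.hull ℝ S) hℓx.le (hTS h)
    rwa [smul_inv_smul₀ hℓx.ne'] at hmem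
  obtain ⟨f, u, hfu, hux⟩ := geometric_hahn_banach_closed_point (convex_convexHull ℝ T)
    ((hfin.image _).isClosed_convexHull ℝ) hxT
  rw [map_smul, smul_eq_mul, lt_inv_mul_iff₀ hℓx] at hux
  refine ⟨(f : V →ₗ[ℝ] ℝ) - u • ℓ, fun v hv => ?_, by simpa [mul_comm u] using hux⟩
  have hfv := hfu _ (subset_convexHull ℝ T ⟨v, hv, rfl⟩)
  rw [map_smul, smul_eq_mul, inv_mul_lt_iff₀ (hS v hv)] at hfv
  simpa [mul_comm u] using hfv.le

theorem exists_form_vanishing_pos (hS : Submodule.span ℝ S = ⊤) {W : Submodule ℝ V}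
    (hW : W ≠ ⊤) : ∃ d : V →ₗ[ℝ] ℝ, W ≤ LinearMap.ker d ∧ ∃ v ∈ S, 0 < d v := by
  obtain ⟨d, hd, hWd⟩ := Submodule.exists_le_ker_of_lt_top W hW.lt_top
  obtain ⟨v, hv, hdv⟩ : ∃ v ∈ S, d v ≠ 0 := by
    by_contra! h
    exact hd (LinearMap.ext_on hS h)
  rcases hdv.lt_or_gt with hneg | hpos
  · exact ⟨-d, fun w hw => by simpa using hWd hw, v, hv, by simpa using hneg⟩
  · exact ⟨d, hWd, v, hv, hpos⟩

theorem exists_form_zeros_ssubset (hfin : S.Finite) (hS : Submodule.span ℝ S = ⊤) {x : V}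
    {f : V →ₗ[ℝ] ℝ} (hf : ∀ v ∈ S, f v ≤ 0)
    (hne : Submodule.span ℝ (insert x {v | v ∈ S ∧ f v = 0}) ≠ ⊤) :
    ∃ g : V →ₗ[ℝ] ℝ, (∀ v ∈ S, g v ≤ 0) ∧ g x = f x ∧
      {v | v ∈ S ∧ f v = 0} ⊂ {v | v ∈ S ∧ g v = 0} := by
  obtain ⟨d, hd, hpos⟩ := exists_form_vanishing_pos hS hne
  have hdx : d x = 0 := hd (Submodule.subset_span (Set.mem_insert _ _))
  have hd0 {v : V} (hv : v ∈ S) (hfv : f v = 0) : d v = 0 :=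
    hd (Submodule.subset_span (Set.mem_insert_of_mem _ ⟨hv, hfv⟩))
  -- Tilt `f` towards `d` until the first further generator lies in the kernel.
  obtain ⟨w, ⟨hw, hdw⟩, hmin⟩ := (hfin.sep fun v => 0 < d v).exists_minimalFor
    (fun v => -f v / d v) _ hpos
  set t := -f w / d w with ht
  have ht0 : 0 ≤ t := div_nonneg (neg_nonneg.2 (hf w hw)) hdw.le
  refine ⟨f + t • d, fun v hv => ?_, by simp [hdx], ?_⟩
  · rcases le_or_gt (d v) 0 with hdv | hdv
    · simpa using add_nonpos (hf v hv) (mul_nonpos_of_nonneg_of_nonpos ht0 hdv)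
    · have htv : t ≤ -f v / d v := le_of_not_gt fun h => h.not_ge (hmin ⟨hv, hdv⟩ h.le)
      rw [le_div_iff₀ hdv] at htv
      simpa [add_comm] using le_neg_iff_add_nonpos_right.1 htv
  · have hwt : (f + t • d) w = 0 := by simp [ht, div_mul_cancel₀ _ hdw.ne']
    exact ⟨fun v hv => ⟨hv.1, by simp [hv.2, hd0 hv.1 hv.2]⟩,
      fun h => hdw.ne' (hd0 hw (h ⟨hw, hwt⟩).2)⟩

theorem exists_facet_form (hfin : S.Finite) (hS : Submodule.span ℝ S = ⊤) {x : V}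
    (h : ∃ f : V →ₗ[ℝ] ℝ, (∀ v ∈ S, f v ≤ 0) ∧ 0 < f x) :
    ∃ f : V →ₗ[ℝ] ℝ, (∀ v ∈ S, f v ≤ 0) ∧ 0 < f x ∧
      Submodule.span ℝ {v | v ∈ S ∧ f v = 0} = LinearMap.ker f := by
  have hzeros : ((fun f : V →ₗ[ℝ] ℝ => {v | v ∈ S ∧ f v = 0}) ''
      {f | (∀ v ∈ S, f v ≤ 0) ∧ 0 < f x}).Finite :=
    hfin.finite_subsets.subset (by rintro _ ⟨f, -, rfl⟩ v hv; exact hv.1)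
  obtain ⟨f, ⟨hf, hfx⟩, hmax⟩ := Set.Finite.exists_maximalFor' _ _ hzeros h
  have hle : Submodule.span ℝ {v | v ∈ S ∧ f v = 0} ≤ LinearMap.ker f :=
    Submodule.span_le.2 fun v hv => hv.2
  have htop : Submodule.span ℝ (insert x {v | v ∈ S ∧ f v = 0}) = ⊤ := by
    by_contra hne
    obtain ⟨g, hg, hgx, hss⟩ := exists_form_zeros_ssubset hfin hS hf hne
    exact hss.2 (hmax ⟨hg, hgx ▸ hfx⟩ hss.1)
  refine ⟨f, hf, hfx, le_antisymm hle fun y hy => ?_⟩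
  obtain ⟨a, z, hz, rfl⟩ := Submodule.mem_span_insert.1 (htop ▸ Submodule.mem_top : y ∈ _)
  have hax : a * f x = 0 := by simpa [LinearMap.mem_ker.1 (hle hz)] using hy
  simpa [(mul_eq_zero.1 hax).resolve_right hfx.ne'] using hz

end Cone

/-! ### Ideal polyhedra -/

theorem mink_neg_of_lightlike {v w : Mink} (hv : mink v v = 0) (hv0 : 0 < v 0)
    (hw : mink w w = 0) (hw0 : 0 < w 0) (h : w ∉ Submodule.span ℝ {v}) : mink v w < 0 := by
  have hne : v 0 • w - w 0 • v ≠ 0 := fun h0 => h <| by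
    refine Submodule.mem_span_singleton.2 ⟨(v 0)⁻¹ * w 0, ?_⟩
    rw [mul_smul, ← sub_eq_zero.1 h0, inv_smul_smul₀ hv0.ne']
  have hpos : 0 < mink (v 0 • w - w 0 • v) (v 0 • w - w 0 • v) := by
    refine mink_self_pos_of_orthogonal (u := ![1, 0, 0, 0]) (by simp [mink]) ?_ hne
    simp [mink, mul_comm]
  simp only [mink_sub_left, mink_sub_right, mink_smul_left, mink_smul_right, hv, hw,
    mink_comm w v] at hpos
  nlinarith [mul_pos hv0 hw0]

theorem exists_spacelike_eq_smul {e : Mink} (he : 0 < mink e e) :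
    ∃ (e' : Spacelike) (c : ℝ), 0 < c ∧ e'.1 = c • e := by
  refine ⟨⟨(√(mink e e))⁻¹ • e, ?_⟩, _, inv_pos.2 (Real.sqrt_pos.2 he), rfl⟩
  rw [mink_smul_left, mink_smul_right, ← mul_assoc, ← mul_inv, Real.mul_self_sqrt he.le,
    inv_mul_cancel₀ he.ne']

section IdealHull

variable {P : Set H3} {S : Set Mink}

theorem exists_H3_mem_hull (hS : ∀ v ∈ S, mink v v = 0 ∧ 0 < v 0)
    (hrank : 2 ≤ Module.finrank ℝ (Submodule.span ℝ S)) :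
    ∃ q : H3, q.1 ∈ PointedCone.hull ℝ S := by
  obtain ⟨v, hv⟩ : S.Nonempty := by
    rw [Set.nonempty_iff_ne_empty]
    rintro rfl
    rw [Submodule.span_empty, finrank_bot] at hrank
    omega
  obtain ⟨w, hw, hwv⟩ : ∃ w ∈ S, w ∉ Submodule.span ℝ {v} := by
    by_contra! h
    have hcard := (Submodule.finrank_mono (Submodule.span_le.2 h)).trans
      (finrank_span_le_card (R := ℝ) ({v} : Set Mink))
    simp only [Set.toFinset_singleton, Finset.card_singleton] at hcard
    omega
  have hvw := mink_neg_of_lightlike (hS v hv).1 (hS v hv).2 (hS w hw).1 (hS w hw).2 hwv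
  have hneg : mink (v + w) (v + w) < 0 := by
    simp only [mink_add_left, mink_add_right, (hS v hv).1, (hS w hw).1, mink_comm w v]
    linarith
  obtain ⟨q, c, hc, hq⟩ := exists_H3_eq_smul hneg (add_pos (hS v hv).2 (hS w hw).2)
  exact ⟨q, hq ▸ PointedCone.smul_mem _ hc.le
    (add_mem (PointedCone.subset_hull hv) (PointedCone.subset_hull hw))⟩

theorem span_eq_top_of_interior_nonempty
    (hP : ∀ x : H3, x ∈ P ↔ x.1 ∈ PointedCone.hull ℝ S) (hint : (interior P).Nonempty) :
    Submodule.span ℝ S = ⊤ := by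
  obtain ⟨w, hw⟩ := hint
  have hspan {x : H3} (hx : x ∈ P) : x.1 ∈ Submodule.span ℝ S :=
    PointedCone.hull_le_span ℝ S ((hP x).1 hx)
  refine Submodule.eq_top_iff'.2 fun v => ?_
  obtain ⟨z, hzP, t, ht, c, hc, hz⟩ := exists_mem_eq_smul_add (mem_interior_iff_mem_nhds.1 hw) v
  have hv : v = t⁻¹ • (c⁻¹ • z.1 - w.1) := by
    rw [hz, inv_smul_smul₀ hc.ne', add_sub_cancel_left, inv_smul_smul₀ ht.ne']
  rw [hv]
  exact Submodule.smul_mem _ _ (Submodule.sub_mem _ (Submodule.smul_mem _ _ (hspan hzP))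
    (hspan (interior_subset hw)))

theorem mem_faceNormals_of_span_eq (hS : ∀ v ∈ S, mink v v = 0 ∧ 0 < v 0)
    (hP : ∀ x : H3, x ∈ P ↔ x.1 ∈ PointedCone.hull ℝ S) {e : Spacelike}
    (he : ∀ v ∈ S, mink v e.1 ≤ 0)
    (hspan : Submodule.span ℝ {v | v ∈ S ∧ mink v e.1 = 0} = LinearMap.ker (minkForm e.1))
    {q : H3} (hq : q ∈ face P e) : e ∈ faceNormals P := by
  refine ⟨fun x hx => map_nonpos_of_mem_hull (f := minkForm e.1) he ((hP x).1 hx), ?_⟩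
  suffices h : LinearMap.ker (minkForm e.1) ≤
      Submodule.span ℝ ((fun x : H3 => x.1) '' face P e) by
    rw [← le_antisymm h (span_face_le P e), finrank_ker_minkForm e.ne_zero]
  rw [← hspan, Submodule.span_le]
  rintro v ⟨hv, hve⟩
  obtain ⟨z, c, hc, hz⟩ := exists_H3_eq_smul_add q (hS v hv).1.le (hS v hv).2 zero_le_one
  rw [one_smul] at hz
  have hzP : z ∈ face P e := by
    refine ⟨(hP z).2 ?_, ?_⟩
    · rw [hz]
      exact PointedCone.smul_mem _ hc.le
        (add_mem ((hP q).1 hq.1) (PointedCone.subset_hull hv))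
    · simp [wall, hz, mink_smul_left, mink_add_left, hve, show mink q.1 e.1 = 0 from hq.2]
  have hv' : v = c⁻¹ • z.1 - q.1 := by rw [hz, inv_smul_smul₀ hc.ne', add_sub_cancel_left]
  rw [hv']
  exact Submodule.sub_mem _ (Submodule.smul_mem _ _ (Submodule.subset_span ⟨z, hzP, rfl⟩))
    (Submodule.subset_span ⟨q, hq, rfl⟩)

theorem exists_faceNormal_pos (hfin : S.Finite) (hS : ∀ v ∈ S, mink v v = 0 ∧ 0 < v 0)
    (hP : ∀ x : H3, x ∈ P ↔ x.1 ∈ PointedCone.hull ℝ S) (hint : (interior P).Nonempty) {x : H3}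
    (hx : x ∉ P) : ∃ e ∈ faceNormals P, 0 < mink x.1 e.1 := by
  obtain ⟨f, hf, hfx, hspan⟩ := exists_facet_form hfin (span_eq_top_of_interior_nonempty hP hint)
    (exists_form_nonpos_pos hfin (ℓ := LinearMap.proj 0) (fun v hv => (hS v hv).2) x.2.2
      (mt (hP x).2 hx))
  obtain ⟨e, rfl⟩ := minkForm_surjective f
  simp only [minkForm_apply] at hf hfx hspan
  have hne : e ≠ 0 := by
    rintro rfl
    simp [mink] at hfx
  obtain ⟨q, hq⟩ := exists_H3_mem_hull (S := {v | v ∈ S ∧ mink v e = 0})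
    (fun v hv => hS v hv.1) (by rw [hspan, finrank_ker_minkForm hne]; norm_num)
  have hqe : mink q.1 e = 0 := by
    have := PointedCone.hull_le_span ℝ _ hq
    rwa [Submodule.restrictScalars_mem, hspan] at this
  -- Being orthogonal to a point of hyperbolic space, `e` is spacelike.
  obtain ⟨e', c, hc, he'⟩ :=
    exists_spacelike_eq_smul (mink_self_pos_of_orthogonal (mink_self_H3_neg q) hqe hne)
  have hee' (y : Mink) : mink y e'.1 = c * mink y e := by rw [he', mink_smul_right]
  have hzero (y : Mink) : mink y e'.1 = 0 ↔ mink y e = 0 := by simp [hee', hc.ne']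
  refine ⟨e', mem_faceNormals_of_span_eq hS hP (q := q) (fun v hv => ?_) ?_ ⟨?_, ?_⟩, ?_⟩
  · rw [hee']
    exact mul_nonpos_of_nonneg_of_nonpos hc.le (hf v hv)
  · simp only [hzero, hspan]
    ext y
    simp [hzero]
  · exact (hP q).2 (Submodule.span_mono (fun v hv => hv.1) hq)
  · exact (hzero _).2 hqe
  · rw [hee']
    exact mul_pos hc hfx

theorem mink_nonpos_of_subset_halfSpace (hS : ∀ v ∈ S, mink v v = 0 ∧ 0 < v 0)
    (hP : ∀ x : H3, x ∈ P ↔ x.1 ∈ PointedCone.hull ℝ S) (hne : P.Nonempty) {e : Spacelike}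
    (he : P ⊆ halfSpace e) {v : Mink} (hv : v ∈ S) : mink v e.1 ≤ 0 := by
  obtain ⟨z, hz⟩ := hne
  have hray {t : ℝ} (ht : 0 ≤ t) : mink z.1 e.1 + t * mink v e.1 ≤ 0 := by
    obtain ⟨q, c, hc, hq⟩ := exists_H3_eq_smul_add z (hS v hv).1.le (hS v hv).2 ht
    have hqe : mink q.1 e.1 ≤ 0 := he <| (hP q).2 <| hq ▸ PointedCone.smul_mem _ hc.le
      (add_mem ((hP z).1 hz) (PointedCone.smul_mem _ ht (PointedCone.subset_hull hv)))
    rw [hq, mink_smul_left, mink_add_left, mink_smul_left] at hqe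
    exact nonpos_of_mul_nonpos_right hqe hc
  by_contra! hpos
  have hze : mink z.1 e.1 ≤ 0 := he hz
  have := hray (t := (1 - mink z.1 e.1) / mink v e.1) (div_nonneg (by linarith) hpos.le)
  rw [div_mul_cancel₀ _ hpos.ne'] at this
  linarith

theorem finite_faceNormals (hfin : S.Finite) (hS : ∀ v ∈ S, mink v v = 0 ∧ 0 < v 0)
    (hP : ∀ x : H3, x ∈ P ↔ x.1 ∈ PointedCone.hull ℝ S) (hint : (interior P).Nonempty) :
    (faceNormals P).Finite := by
  obtain ⟨w, hw⟩ := hint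
  -- A face is determined by the ideal vertices on its plane.
  refine Set.Finite.of_finite_image (f := fun e => {v | v ∈ S ∧ mink v e.1 = 0})
    (hfin.finite_subsets.subset (by rintro _ ⟨e, -, rfl⟩ v hv; exact hv.1)) ?_
  intro e he e' he' (hee' : {v | v ∈ S ∧ mink v e.1 = 0} = {v | v ∈ S ∧ mink v e'.1 = 0})
  refine (eq_of_face_subset_wall he (fun x hx => ?_) (interior_subset hw)
    (mink_neg_of_mem_interior he'.1 hw)).symm
  have hmem := mem_hull_of_map_eq_zero (f := minkForm e.1)
    (fun v hv => mink_nonpos_of_subset_halfSpace hS hP ⟨w, interior_subset hw⟩ he.1 hv)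
    ((hP x).1 hx.1) hx.2
  simp only [minkForm_apply, hee'] at hmem
  have hle : Submodule.span ℝ {v | v ∈ S ∧ mink v e'.1 = 0} ≤ LinearMap.ker (minkForm e'.1) :=
    Submodule.span_le.2 fun v hv => hv.2
  exact hle (PointedCone.hull_le_span ℝ _ hmem)

end IdealHull

theorem IsIdealPolyhedron.isPolyhedron {P : Set H3} (h : IsIdealPolyhedron P) :
    IsPolyhedron P := by
  obtain ⟨hint, S, hS, hP⟩ := h
  replace hP (x : H3) : x ∈ P ↔ x.1 ∈ PointedCone.hull ℝ (S : Set Mink) :=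
    (hP x).trans mem_hull_finset.symm
  refine ⟨finite_faceNormals S.finite_toSet hS hP hint, fun x => ⟨fun hx e he => he.1 hx, ?_⟩,
    hint⟩
  contrapose!
  exact exists_faceNormal_pos S.finite_toSet hS hP hint

/-! ### Right-angled polyhedra -/

theorem exists_mem_wall {x : H3} {e : Spacelike} (hxe : mink x.1 e.1 ≤ 0) :
    ∃ y ∈ wall e, ∃ r > (0 : ℝ), ∃ s ≥ (0 : ℝ), y.1 = r • x.1 + s • e.1 := by
  set v : Mink := x.1 - mink x.1 e.1 • e.1 with hv
  have hvx : mink v x.1 < 0 := by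
    rw [hv, mink_sub_left, mink_smul_left, x.2.1, mink_comm e.1]
    nlinarith [sq_nonneg (mink x.1 e.1)]
  have hve : mink v e.1 = 0 := by rw [hv, mink_sub_left, mink_smul_left, e.2]; ring
  have hvv : mink v v < 0 := by
    rwa [show mink v v = mink v x.1 by
      nth_rw 2 [hv]; rw [mink_sub_right, mink_smul_right, hve]; ring]
  obtain ⟨y, c, hc, hy⟩ := exists_H3_eq_smul hvv (future_of_mink_neg hvv.le hvx)
  refine ⟨y, ?_, c, hc, c * -mink x.1 e.1, mul_nonneg hc.le (by linarith), by rw [hy, hv]; module⟩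
  rw [wall, Set.mem_ofPred_eq, hy, mink_smul_left, hve, mul_zero]

theorem exists_mem_wall_inter_wall {z : H3} {e e' : Spacelike} (hz : mink z.1 e.1 < 0)
    (hz' : mink z.1 e'.1 < 0) (hlt : -1 < mink e.1 e'.1) (hle : mink e.1 e'.1 ≤ 0) :
    ∃ y ∈ wall e ∩ wall e', ∃ r > (0 : ℝ), ∃ s ≥ (0 : ℝ), ∃ s' ≥ (0 : ℝ),
      y.1 = r • z.1 + s • e.1 + s' • e'.1 := by
  set k := mink e.1 e'.1 with hk
  set p := mink z.1 e.1 with hp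
  set p' := mink z.1 e'.1 with hp'
  have hD : 0 < 1 - k ^ 2 := by nlinarith
  have hs : 0 ≤ k * p' - p := by nlinarith
  have hs' : 0 ≤ k * p - p' := by nlinarith
  -- A positive multiple of the projection of `z` to the orthogonal complement of `e` and `e'`.
  set v := (1 - k ^ 2) • z.1 + (k * p' - p) • e.1 + (k * p - p') • e'.1 with hv
  have hve : mink v e.1 = 0 := by
    simp only [hv, mink_add_left, mink_smul_left, e.2, mink_comm e'.1 e.1, ← hk, ← hp]; ring
  have hve' : mink v e'.1 = 0 := by
    simp only [hv, mink_add_left, mink_smul_left, e'.2, ← hk, ← hp']; ring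
  have hvz : mink v z.1 < 0 := by
    simp only [hv, mink_add_left, mink_smul_left, z.2.1, mink_comm e.1 z.1, mink_comm e'.1 z.1,
      ← hp, ← hp']
    linarith [mul_nonpos_of_nonneg_of_nonpos hs hz.le, mul_nonpos_of_nonneg_of_nonpos hs' hz'.le]
  have hvv : mink v v < 0 := by
    have hvv' : mink v v = (1 - k ^ 2) * mink v z.1 := by
      nth_rw 2 [hv]
      simp only [mink_add_right, mink_smul_right, hve, hve']
      ring
    rw [hvv']
    exact mul_neg_of_pos_of_neg hD hvz
  obtain ⟨y, c, hc, hy⟩ := exists_H3_eq_smul hvv (future_of_mink_neg hvv.le hvz)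
  refine ⟨y, ⟨?_, ?_⟩, c * (1 - k ^ 2), mul_pos hc hD, c * (k * p' - p), mul_nonneg hc.le hs,
    c * (k * p - p'), mul_nonneg hc.le hs', by rw [hy, hv]; module⟩
  · rw [wall, Set.mem_ofPred_eq, hy, mink_smul_left, hve, mul_zero]
  · rw [wall, Set.mem_ofPred_eq, hy, mink_smul_left, hve', mul_zero]

namespace IsPolyhedron

variable {P : Set H3} {e e' : Spacelike}

theorem exists_exit_point (hP : IsPolyhedron P) {w y : H3} (hw : w ∈ P) (hy : y ∉ P) :
    ∃ b ∈ faceNormals P, 0 < mink y.1 b.1 ∧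
      ∃ q ∈ face P b, ∃ c t : ℝ, q.1 = c • (w.1 + t • y.1) := by
  have hle {a : Spacelike} (ha : a ∈ faceNormals P) : mink w.1 a.1 ≤ 0 := ha.1 hw
  obtain ⟨b, ⟨hb, hyb⟩, hmin⟩ := (hP.finite.sep fun a => 0 < mink y.1 a.1).exists_minimalFor
    (fun a => -mink w.1 a.1 / mink y.1 a.1) _
    (by
      rw [hP.mem_iff] at hy
      push Not at hy
      exact hy)
  set t := -mink w.1 b.1 / mink y.1 b.1 with ht_def
  have ht : 0 ≤ t := div_nonneg (neg_nonneg.2 (hle hb)) hyb.le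
  obtain ⟨q, c, hc, hq⟩ := exists_H3_eq_smul_add w (mink_self_H3_neg y).le y.2.2 ht
  have hqmink (a : Spacelike) : mink q.1 a.1 = c * (mink w.1 a.1 + t * mink y.1 a.1) := by
    rw [hq, mink_smul_left, mink_add_left, mink_smul_left]
  refine ⟨b, hb, hyb, q, ⟨(hP.mem_iff q).2 fun a ha => ?_, ?_⟩, c, t, hq⟩
  · rw [hqmink]
    refine mul_nonpos_of_nonneg_of_nonpos hc.le ?_
    rcases le_or_gt (mink y.1 a.1) 0 with hya | hya
    · exact add_nonpos (hle ha) (mul_nonpos_of_nonneg_of_nonpos ht hya)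
    · have hta : t ≤ -mink w.1 a.1 / mink y.1 a.1 :=
        le_of_not_gt fun h => h.not_ge (hmin ⟨ha, hya⟩ h.le)
      rw [le_div_iff₀ hya] at hta
      linarith
  · rw [wall, Set.mem_ofPred_eq, hqmink, ht_def, div_mul_cancel₀ _ hyb.ne']
    ring

theorem mem_of_forall_adjacent (hP : IsPolyhedron P) (he : e ∈ faceNormals P) {y : H3}
    (hye : y ∈ wall e) (hy : ∀ a ∈ faceNormals P, Adjacent P e a → mink y.1 a.1 ≤ 0) :
    y ∈ P := by
  by_contra hyP
  obtain ⟨w, hwP, hwe : mink w.1 e.1 = 0⟩ := face_nonempty he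
  replace hye : mink y.1 e.1 = 0 := hye
  obtain ⟨b, hb, hyb, q, hq, c, t, hqeq⟩ := hP.exists_exit_point hwP hyP
  have hqe : q ∈ wall e := by
    simp [wall, hqeq, mink_smul_left, mink_add_left, hwe, hye]
  have hne : e ≠ b := by
    rintro rfl
    exact hyb.ne' hye
  exact (hy b hb ⟨hne, q, ⟨hq.1, hqe⟩, hq⟩).not_gt hyb

theorem mink_faceNormals_nonpos (hP : IsPolyhedron P) (hra : IsRightAngled P)
    (he : e ∈ faceNormals P) (he' : e' ∈ faceNormals P) (hne : e ≠ e') :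
    mink e.1 e'.1 ≤ 0 := by
  obtain ⟨z, hz⟩ := hP.interior_nonempty
  obtain ⟨x, hx, hxe⟩ : ∃ x ∈ face P e', mink x.1 e.1 < 0 := by
    by_contra! h
    exact hne (eq_of_face_subset_wall he' (fun x hx => le_antisymm (he.1 hx.1) (h x hx))
      (interior_subset hz) (mink_neg_of_mem_interior he.1 hz))
  -- Right angles keep the foot of the perpendicular from `x` to the plane of `e` inside `P`.
  obtain ⟨y, hye, r, hr, s, hs, hy⟩ := exists_mem_wall hxe.le
  have hyP : y ∈ P := hP.mem_of_forall_adjacent he hye fun a ha hadj => by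
    rw [hy, mink_add_left, mink_smul_left, mink_smul_left, hra e he a ha hadj, mul_zero, add_zero]
    exact mul_nonpos_of_nonneg_of_nonpos hr.le (ha.1 hx.1)
  have hye' : mink y.1 e'.1 ≤ 0 := he'.1 hyP
  have hs0 : s ≠ 0 := by
    rintro rfl
    have hye : mink y.1 e.1 = 0 := hye
    rw [hy, zero_smul, add_zero, mink_smul_left] at hye
    exact (mul_neg_of_pos_of_neg hr hxe).ne hye
  rw [hy, mink_add_left, mink_smul_left, mink_smul_left, show mink x.1 e'.1 = 0 from hx.2,
    mul_zero, zero_add] at hye'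
  exact nonpos_of_mul_nonpos_right hye' (lt_of_le_of_ne hs hs0.symm)

theorem mink_faceNormals_eq_zero_or_le (hP : IsPolyhedron P) (hra : IsRightAngled P)
    (he : e ∈ faceNormals P) (he' : e' ∈ faceNormals P) (hne : e ≠ e') :
    mink e.1 e'.1 = 0 ∨ mink e.1 e'.1 ≤ -1 := by
  by_contra! ⟨hzero, hlt⟩
  obtain ⟨z, hz⟩ := hP.interior_nonempty
  have hneg {a : Spacelike} (ha : a ∈ faceNormals P) := mink_neg_of_mem_interior ha.1 hz
  obtain ⟨y, hy, r, hr, s, hs, s', hs', hyeq⟩ := exists_mem_wall_inter_wall (hneg he) (hneg he')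
    hlt (hP.mink_faceNormals_nonpos hra he he' hne)
  have hyP : y ∈ P := (hP.mem_iff y).2 fun a ha => by
    by_cases hae : e = a
    · exact hae ▸ hy.1.le
    by_cases hae' : e' = a
    · exact hae' ▸ hy.2.le
    rw [hyeq, mink_add_left, mink_add_left, mink_smul_left, mink_smul_left, mink_smul_left]
    linarith [mul_neg_of_pos_of_neg hr (hneg ha),
      mul_nonpos_of_nonneg_of_nonpos hs (hP.mink_faceNormals_nonpos hra he ha hae),
      mul_nonpos_of_nonneg_of_nonpos hs' (hP.mink_faceNormals_nonpos hra he' ha hae')]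
  exact hzero (hra e he e' he' ⟨hne, y, ⟨hyP, hy.1⟩, hyP, hy.2⟩)

theorem exists_isChamber (hP : IsPolyhedron P) (hra : IsRightAngled P) :
    ∃ x₀, IsChamber (faceNormals P) P x₀ := by
  obtain ⟨z, hz⟩ := hP.interior_nonempty
  exact ⟨z, hP.finite, hP.mem_iff,
    fun e he e' he' hne => hP.mink_faceNormals_eq_zero_or_le hra he he' hne,
    fun e he => mink_neg_of_mem_interior he.1 hz⟩

end IsPolyhedron

/-! ### Intermediate coverings -/

section IntermediateCovering

open scoped Pointwise

variable {E X Y G : Type*} [Group G] [MulAction G E] {H : Subgroup G} {f : E → X} {q : E → Y}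
  {r : Y → X} {U : Set E}

theorem image_smul_eq_of_not_disjoint (hq : ∀ {a b}, q a = q b ↔ a ∈ MulAction.orbit H b)
    (hU : ∀ g : G, (g • U ∩ U).Nonempty → g = 1) {a b : G}
    (hab : ¬Disjoint (q '' (a • U)) (q '' (b • U))) : q '' (a • U) = q '' (b • U) := by
  obtain ⟨_, ⟨_, ⟨u, hu, rfl⟩, rfl⟩, ⟨_, ⟨v, hv, rfl⟩, hvu⟩⟩ := Set.not_disjoint_iff.1 hab
  obtain ⟨c, hc : c.1 • a • u = b • v⟩ := hq.1 hvu
  have hone : b⁻¹ * (c.1 * a) = 1 := hU _ ⟨v, ⟨u, hu, by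
    simp only [mul_smul, hc, inv_smul_smul]⟩, hv⟩
  rw [inv_mul_eq_one.1 hone, mul_smul, ← Set.image_smul (a := c.1), Set.image_image]
  exact Set.image_congr fun w _ => (hq.2 ⟨c, rfl⟩).symm

theorem injOn_image_smul (hf : ∀ {a b}, f a = f b ↔ a ∈ MulAction.orbit G b)
    (hrq : ∀ a, r (q a) = f a) (hU : ∀ g : G, (g • U ∩ U).Nonempty → g = 1) (g : G) :
    Set.InjOn r (q '' (g • U)) := by
  rintro _ ⟨_, ⟨u, hu, rfl⟩, rfl⟩ _ ⟨_, ⟨v, hv, rfl⟩, rfl⟩ huv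
  rw [hrq, hrq] at huv
  obtain ⟨c, hc : c • g • v = g • u⟩ := hf.1 huv
  have hone : g⁻¹ * (c * g) = 1 := hU _ ⟨u, ⟨v, hv, by
    simp only [mul_smul, hc, inv_smul_smul]⟩, hu⟩
  have hc1 : c = 1 := mul_eq_right.1 (inv_mul_eq_one.1 hone).symm
  simp only [← hc, hc1, one_smul]

variable [TopologicalSpace E] [TopologicalSpace X] [TopologicalSpace Y]

theorem isEvenlyCovered_of_sheets (hr : Continuous r) (hro : IsOpenMap r) {V : Set X}
    (hV : IsOpen V) {x : X} (hx : x ∈ V) {𝒮 : Set (Set Y)} (hopen : ∀ S ∈ 𝒮, IsOpen S)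
    (hinj : ∀ S ∈ 𝒮, Set.InjOn r S) (hsurj : ∀ S ∈ 𝒮, Set.SurjOn r S V)
    (hdisj : 𝒮.PairwiseDisjoint id) (hcover : r ⁻¹' V ⊆ ⋃₀ 𝒮) :
    IsEvenlyCovered r x (r ⁻¹' {x}) := by
  rcases 𝒮.eq_empty_or_nonempty with rfl | ⟨S, hS⟩
  · have hempty : r ⁻¹' V = ∅ := Set.subset_empty_iff.1 (by simpa using hcover)
    exact .to_isEvenlyCovered_preimage (.of_preimage_eq_empty Empty (hV.mem_nhds hx) hempty)
  obtain ⟨y, -, -⟩ := hsurj S hS hx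
  have : Nonempty (X → Y) := ⟨fun _ => y⟩
  have : Nonempty 𝒮 := ⟨⟨S, hS⟩⟩
  let : TopologicalSpace 𝒮 := ⊥
  have : DiscreteTopology 𝒮 := ⟨rfl⟩
  have hopen_iff (S : 𝒮) {W : Set X} (hWV : W ⊆ V) : IsOpen W ↔ IsOpen (r ⁻¹' W ∩ S.1) := by
    refine ⟨fun hW => (hW.preimage hr).inter (hopen _ S.2), fun hW => ?_⟩
    have himage := hro _ hW
    rwa [Set.image_preimage_inter, Set.inter_eq_left.2 (hWV.trans (hsurj _ S.2))] at himage
  let t := IsOpen.trivializationDiscrete (f := r) (fun S : 𝒮 => S.1) V hV hopen_iff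
    (fun S => hinj _ S.2) (fun S => hsurj _ S.2) hdisj.subtype
    (by rwa [← Set.sUnion_eq_iUnion])
  exact .to_isEvenlyCovered_preimage (.of_trivialization (t := t) hx)

/-- The sheets over the image of a small open set `U` are the images of its translates under the
whole group `G`. -/
theorem isCoveringMap_of_isQuotientCoveringMap_comp (hf : IsQuotientCoveringMap f G)
    (hqo : IsOpenQuotientMap q) (hq : ∀ {a b}, q a = q b ↔ a ∈ MulAction.orbit H b)
    (hrq : ∀ a, r (q a) = f a) : IsCoveringMap r := by
  have := hf.toContinuousConstSMul
  have hf_smul (g : G) (a : E) : f (g • a) = f a := hf.apply_eq_iff_mem_orbit.2 ⟨g, rfl⟩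
  have hr : IsOpenQuotientMap r := hqo.of_comp_iff.1 <| by
    rw [show r ∘ q = f from funext hrq]; exact hf.isOpenQuotientMap
  intro x
  obtain ⟨a, rfl⟩ := hf.surjective x
  obtain ⟨U₀, hU₀, hdisj⟩ := hf.disjoint a
  set U := interior U₀
  have hU (g : G) (hg : (g • U ∩ U).Nonempty) : g = 1 := hdisj g <| hg.mono <|
    Set.inter_subset_inter (Set.image_mono interior_subset) interior_subset
  refine isEvenlyCovered_of_sheets hr.continuous hr.isOpenMap
    (hf.isOpenQuotientMap.isOpenMap _ isOpen_interior)
    ⟨a, mem_interior_iff_mem_nhds.2 hU₀, rfl⟩ (𝒮 := Set.range fun g : G => q '' (g • U))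
    ?_ ?_ ?_ ?_ ?_
  · rintro _ ⟨g, rfl⟩
    exact hqo.isOpenMap _ (isOpen_interior.smul g)
  · rintro _ ⟨g, rfl⟩
    exact injOn_image_smul hf.apply_eq_iff_mem_orbit hrq hU g
  · rintro _ ⟨g, rfl⟩ _ ⟨u, hu, rfl⟩
    exact ⟨q (g • u), ⟨_, ⟨u, hu, rfl⟩, rfl⟩, (hrq _).trans (hf_smul g u)⟩
  · rintro _ ⟨g, rfl⟩ _ ⟨g', rfl⟩ hne
    by_contra hnd
    exact hne (image_smul_eq_of_not_disjoint hq hU hnd)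
  · intro y hy
    obtain ⟨b, rfl⟩ := hqo.surjective y
    obtain ⟨u, hu, hub⟩ := hy
    obtain ⟨g, rfl⟩ := hf.apply_eq_iff_mem_orbit.1 (hub.trans (hrq b)).symm
    exact ⟨_, ⟨g, rfl⟩, _, ⟨u, hu, rfl⟩, rfl⟩

end IntermediateCovering

/-! ### Topology of hyperbolic space -/

theorem isClosed_hyperboloid : IsClosed {x : Mink | mink x x = -1 ∧ 0 < x 0} := by
  have hcut : {x : Mink | mink x x = -1 ∧ 0 < x 0} = {x | mink x x = -1} ∩ {x | 0 ≤ x 0} := by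
    ext x
    refine ⟨fun h => ⟨h.1, h.2.le⟩, fun h => ⟨h.1, lt_of_le_of_ne h.2 fun h0 => ?_⟩⟩
    have hx : mink x x = -1 := h.1
    simp only [mink, ← h0] at hx
    nlinarith [sq_nonneg (x 1), sq_nonneg (x 2), sq_nonneg (x 3)]
  rw [hcut]
  exact (isClosed_eq (continuous_mink continuous_id continuous_id) continuous_const).inter
    (isClosed_le continuous_const (continuous_apply 0))

instance : LocallyCompactSpace H3 :=
  isClosed_hyperboloid.isClosedEmbedding_subtypeVal.locallyCompactSpace

/-- The vertical projection of the hyperboloid to the spatial coordinates; it shows that hyperbolic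
space is contractible. -/
def spatialHomeomorph : H3 ≃ₜ ℝ × ℝ × ℝ where
  toFun x := (x.1 1, x.1 2, x.1 3)
  invFun y := ⟨![√(1 + y.1 ^ 2 + y.2.1 ^ 2 + y.2.2 ^ 2), y.1, y.2.1, y.2.2], by
    have h : 0 < 1 + y.1 ^ 2 + y.2.1 ^ 2 + y.2.2 ^ 2 := by positivity
    refine ⟨?_, by simpa using h⟩
    simp [mink, Real.mul_self_sqrt h.le]
    ring⟩
  left_inv x := by
    obtain ⟨x, hx, hx0⟩ := x
    have h : 1 + x 1 ^ 2 + x 2 ^ 2 + x 3 ^ 2 = x 0 ^ 2 := by simp only [mink] at hx; linarith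
    ext i
    fin_cases i
    · simp [h, Real.sqrt_sq hx0.le]
    all_goals simp
  right_inv y := by simp
  continuous_toFun := (by fun_prop : Continuous fun v : Mink => (v 1, v 2, v 3)).comp
    continuous_subtype_val
  continuous_invFun := by
    refine Continuous.subtype_mk (continuous_pi fun i => ?_) _
    fin_cases i <;> simp only [Fin.zero_eta, Fin.mk_one, Fin.reduceFinMk, Matrix.cons_val] <;>
      fun_prop

instance : ContractibleSpace H3 := spatialHomeomorph.contractibleSpace

theorem norm_H3_le (y : H3) : ‖y.1‖ ≤ y.1 0 := by
  have hy := y.2.1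
  simp only [mink] at hy
  refine (pi_norm_le_iff_of_nonneg y.2.2.le).2 fun i => abs_le_of_sq_le_sq ?_ y.2.2.le
  fin_cases i <;> simp <;> nlinarith [sq_nonneg (y.1 1), sq_nonneg (y.1 2), sq_nonneg (y.1 3)]

theorem isCompact_setOf_height_le (C : ℝ) : IsCompact {y : H3 | y.1 0 ≤ C} :=
  (isClosed_hyperboloid.isClosedEmbedding_subtypeVal.isCompact_preimage
    (isCompact_closedBall 0 C)).of_isClosed_subset
      (isClosed_le ((continuous_apply 0).comp continuous_subtype_val) continuous_const)
      fun y hy => mem_closedBall_zero_iff.2 ((norm_H3_le y).trans hy)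

/-! ### Discreteness of the reflection group -/

theorem mink_add_smul_self (x : H3) (a : Mink) : mink x.1 (a + mink x.1 a • x.1) = 0 := by
  rw [mink_add_right, mink_smul_right, x.2.1]; ring

theorem mink_add_smul_add_smul (x : H3) (a b : Mink) :
    mink (a + mink x.1 a • x.1) (b + mink x.1 b • x.1) = mink a b + mink x.1 a * mink x.1 b := by
  rw [mink_add_left, mink_smul_left, mink_add_smul_self, mink_add_right, mink_smul_right,
    mink_comm a x.1]
  ring

theorem mink_self_add_sq_nonneg (x : H3) (a : Mink) : 0 ≤ mink a a + mink x.1 a ^ 2 := by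
  rw [pow_two, ← mink_add_smul_add_smul]
  exact mink_self_nonneg_of_orthogonal (mink_self_H3_neg x) (mink_add_smul_self x a)

theorem mink_add_mul_sq_le (x : H3) (a b : Mink) : (mink a b + mink x.1 a * mink x.1 b) ^ 2
    ≤ (mink a a + mink x.1 a ^ 2) * (mink b b + mink x.1 b ^ 2) := by
  simp only [pow_two (mink x.1 _), ← mink_add_smul_add_smul]
  exact mink_sq_le_of_orthogonal (mink_self_H3_neg x) (mink_add_smul_self x a)
    (mink_add_smul_self x b)

/-- A multiplicative triangle inequality for the hyperbolic cosine of the distance. -/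
theorem neg_mink_le (x y z : H3) : -mink x.1 z.1 ≤ 2 * (mink x.1 y.1 * mink y.1 z.1) := by
  have hpos := mul_pos_of_neg_of_neg (mink_H3_neg y x) (mink_H3_neg y z)
  have hgram := mink_add_mul_sq_le y x.1 z.1
  have hx := mink_self_add_sq_nonneg y x.1
  have hz := mink_self_add_sq_nonneg y z.1
  rw [x.2.1] at hx hgram
  rw [z.2.1] at hz hgram
  have hsq : (mink x.1 z.1 + mink y.1 x.1 * mink y.1 z.1) ^ 2
      ≤ (mink y.1 x.1 * mink y.1 z.1) ^ 2 := by nlinarith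
  rw [mink_comm x.1 y.1]
  linarith [(abs_le_of_sq_le_sq' hsq hpos.le).1]

/-- A point closer to `x` than a hyperplane lies on the same side of it as `x`. -/
theorem mink_neg_of_sq_lt {x y : H3} {e : Spacelike} (he : mink x.1 e.1 < 0)
    (hy : mink x.1 y.1 ^ 2 < 1 + mink x.1 e.1 ^ 2) : mink y.1 e.1 < 0 := by
  have hgram := mink_add_mul_sq_le x y.1 e.1
  rw [y.2.1, e.2] at hgram
  by_contra! hcon
  have hpos := mul_pos_of_neg_of_neg (mink_H3_neg x y) he
  nlinarith [mul_nonneg hcon hpos.le, sq_nonneg (mink y.1 e.1)]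

theorem exists_forall_apply_height_le (x₀ : H3) {K L : Set H3} (hK : IsCompact K)
    (hL : IsCompact L) : ∃ C : ℝ, ∀ g ∈ isometries, (g '' K ∩ L).Nonempty → (g x₀).1 0 ≤ C := by
  obtain ⟨C₁, hC₁⟩ := hK.exists_bound_of_continuousOn (f := fun x : H3 => mink x₀.1 x.1)
    (continuous_mink continuous_const continuous_subtype_val).continuousOn
  obtain ⟨C₂, hC₂⟩ := hL.exists_bound_of_continuousOn (f := fun x : H3 => x.1 0)
    ((continuous_apply 0).comp continuous_subtype_val).continuousOn
  refine ⟨2 * (C₁ * C₂), ?_⟩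
  rintro g hg ⟨_, ⟨k, hk, rfl⟩, hgk⟩
  let o : H3 := ⟨![1, 0, 0, 0], by simp [mink]⟩
  have ho (y : H3) : mink y.1 o.1 = -y.1 0 := by simp [o, mink]
  have htri := neg_mink_le (g x₀) (g k) o
  rw [mink_isometry hg, ho, ho, neg_neg, mul_neg, ← neg_mul] at htri
  have hk₁ : -mink x₀.1 k.1 ≤ C₁ := (neg_le_abs _).trans (hC₁ k hk)
  have hk₂ : (g k).1 0 ≤ C₂ := (le_abs_self _).trans (hC₂ _ hgk)
  have hmul : -mink x₀.1 k.1 * (g k).1 0 ≤ C₁ * C₂ :=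
    mul_le_mul hk₁ hk₂ (g k).2.2.le ((neg_pos.2 (mink_H3_neg _ _)).le.trans hk₁)
  linarith

namespace IsChamber

variable {F : Set Spacelike} {P : Set H3} {x₀ : H3}

theorem exists_pos_eq_one (h : IsChamber F P x₀) : ∃ ε > 0,
    ∀ g ∈ Subgroup.closure (reflection '' F), mink x₀.1 (g x₀).1 ^ 2 < 1 + ε → g = 1 := by
  have hev : ∀ᶠ ε in 𝓝[>] (0 : ℝ), ∀ e ∈ F, ε < mink x₀.1 e.1 ^ 2 :=
    ((eventually_all_finite h.finite).2 fun e he =>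
      eventually_lt_nhds (sq_pos_of_neg (h.base e he))).filter_mono nhdsWithin_le_nhds
  obtain ⟨ε, hε, hε0⟩ := (hev.and self_mem_nhdsWithin).exists
  refine ⟨ε, hε0, fun g hg hgx => h.eq_one_of_apply_mem hg ((h.mem_iff _).2 fun e he => ?_)⟩
  exact (mink_neg_of_sq_lt (h.base e he) (by linarith [hε e he])).le

theorem exists_mem_nhds_subsingleton (h : IsChamber F P x₀) (y : H3) :
    ∃ t ∈ 𝓝 y, {g : Subgroup.closure (reflection '' F) | g.1 x₀ ∈ t}.Subsingleton := by
  obtain ⟨ε, hε, hone⟩ := h.exists_pos_eq_one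
  have hcont : Continuous fun p : H3 × H3 => mink p.1.1 p.2.1 ^ 2 :=
    (continuous_mink (by fun_prop) (by fun_prop)).pow 2
  have hnear : ∀ᶠ p in 𝓝 (y, y), mink p.1.1 p.2.1 ^ 2 < 1 + ε :=
    hcont.continuousAt.eventually_lt_const (by simp only [y.2.1]; linarith)
  rw [nhds_prod_eq] at hnear
  obtain ⟨t, ht, hclose⟩ := eventually_prod_self_iff'.1 hnear
  refine ⟨t, ht, fun a ha b hb => inv_mul_eq_one.1 (Subtype.ext (hone _ (a⁻¹ * b).2 ?_))⟩
  rw [← mink_isometry (closure_reflections_le F a.2), ← Equiv.Perm.mul_apply, ← Subgroup.coe_mul,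
    mul_inv_cancel_left]
  exact hclose _ ha _ hb

theorem finite_setOf_apply_mem (h : IsChamber F P x₀) {B : Set H3} (hB : IsCompact B) :
    {g : Subgroup.closure (reflection '' F) | g.1 x₀ ∈ B}.Finite := by
  refine hB.induction_on
    (p := fun B => {g : Subgroup.closure (reflection '' F) | g.1 x₀ ∈ B}.Finite)
    Set.finite_empty (fun s t hst ht => ht.subset fun g hg => hst hg)
    (fun s t hs ht => (hs.union ht).subset fun g hg => hg) fun y _ => ?_
  obtain ⟨t, ht, hsub⟩ := h.exists_mem_nhds_subsingleton y
  exact ⟨t, mem_nhdsWithin_of_mem_nhds ht, hsub.finite⟩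

theorem isQuotientCoveringMap_proj (h : IsChamber F P x₀) {Γ : Subgroup (Equiv.Perm H3)}
    (hΓ : Γ ≤ Subgroup.closure (reflection '' F)) (hfree : ActsFreely Γ) :
    IsQuotientCoveringMap (proj Γ) Γ := by
  have : ContinuousConstSMul Γ H3 :=
    ⟨fun g => continuous_of_mem_isometries (closure_reflections_le F (hΓ g.2))⟩
  have : ProperlyDiscontinuousSMul Γ H3 := by
    refine ⟨fun {K L} hK hL => ?_⟩
    obtain ⟨C, hC⟩ := exists_forall_apply_height_le x₀ hK hL
    refine ((h.finite_setOf_apply_mem (isCompact_setOf_height_le C)).preimage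
      (Subgroup.inclusion_injective hΓ).injOn).subset fun g hg => ?_
    exact hC g.1 (closure_reflections_le F (hΓ g.2)) hg
  have : IsCancelSMul Γ H3 :=
    isCancelSMul_iff_eq_one_of_smul_eq.2 fun g x hgx => Subtype.ext (hfree g.1 g.2 x hgx)
  exact isQuotientCoveringMap_quotientMk_of_properlyDiscontinuousSMul

end IsChamber

/-! ### Covers of a quotient and their fundamental groups -/

theorem ActsFreely.mono {Γ' Γ : Subgroup (Equiv.Perm H3)} (h : Γ' ≤ Γ) (hΓ : ActsFreely Γ) :
    ActsFreely Γ' := fun g hg => hΓ g (h hg)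

theorem proj_eq_iff {Γ : Subgroup (Equiv.Perm H3)} {x y : H3} :
    proj Γ x = proj Γ y ↔ x ∈ MulAction.orbit Γ y := Quotient.eq''

theorem proj_apply {Γ : Subgroup (Equiv.Perm H3)} {g : Equiv.Perm H3} (hg : g ∈ Γ) (x : H3) :
    proj Γ (g x) = proj Γ x := proj_eq_iff.2 ⟨⟨g, hg⟩, rfl⟩

theorem continuous_proj (Γ : Subgroup (Equiv.Perm H3)) : Continuous (proj Γ) :=
  continuous_quot_mk

section Cover

variable {Γ' Γ : Subgroup (Equiv.Perm H3)} (h : Γ' ≤ Γ)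

include h in
theorem isOpenQuotientMap_proj_of_le (hp : IsQuotientCoveringMap (proj Γ) Γ) :
    IsOpenQuotientMap (proj Γ') :=
  have : ContinuousConstSMul Γ' H3 := ⟨fun g => hp.continuous_const_smul ⟨g.1, h g.2⟩⟩
  MulAction.isOpenQuotientMap_quotientMk

theorem isCoveringMap_coverMap (hp : IsQuotientCoveringMap (proj Γ) Γ) :
    IsCoveringMap (coverMap h) := by
  refine isCoveringMap_of_isQuotientCoveringMap_comp (H := Γ'.subgroupOf Γ) hp
    (isOpenQuotientMap_proj_of_le h hp) (fun {a b} => proj_eq_iff.trans ⟨?_, ?_⟩) fun _ => rfl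
  · rintro ⟨g, rfl⟩
    exact ⟨⟨⟨g.1, h g.2⟩, g.2⟩, rfl⟩
  · rintro ⟨g, rfl⟩
    exact ⟨⟨g.1.1, g.2⟩, rfl⟩

/-- The class of the loop in `H3 / Γ` covered by a path from `x` to its translate `g x`. -/
def loop {x : H3} {g : Equiv.Perm H3} (hg : g ∈ Γ) (p : Path x (g x)) :
    FundamentalGroup (HypQuotient Γ) (proj Γ x) :=
  .fromPath (.mk ((p.map (continuous_proj Γ)).cast rfl (proj_apply hg x).symm))

theorem mapOfEq_coverMap_loop {x : H3} {g : Equiv.Perm H3} (hg : g ∈ Γ') (p : Path x (g x)) :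
    FundamentalGroup.mapOfEq (coverMap h) (x := proj Γ' x) (y := proj Γ x) rfl (loop hg p) =
      loop (h hg) p :=
  FundamentalGroup.mapOfEq_apply ..

/-- The isomorphism of the fundamental group of `H3 / Γ` with the deck group `Γ`. Monodromy is an
isomorphism onto the opposite group of `Γ`, whence the inverses. -/
def deckEquiv (hp : IsQuotientCoveringMap (proj Γ) Γ) (x : H3) :
    FundamentalGroup (HypQuotient Γ) (proj Γ x) ≃* Γ :=
  (hp.fundamentalGroupEquiv ⟨x, rfl⟩).trans (MulEquiv.inv' Γ).symm

theorem deckEquiv_loop (hp : IsQuotientCoveringMap (proj Γ) Γ) {x : H3} {g : Equiv.Perm H3}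
    (hg : g ∈ Γ) (p : Path x (g x)) : deckEquiv hp x (loop hg p) = ⟨g, hg⟩⁻¹ := by
  have hdeck : hp.fundamentalGroupToMulOpposite ⟨x, rfl⟩ (loop hg p) = .op ⟨g, hg⟩ :=
    hp.fundamentalGroupToMulOpposite_apply_eq_Iff.2 <| Eq.symm <| congrArg Subtype.val <|
      hp.isCoveringMap.monodromy_eq_of_map_eq (ey := ⟨g x, proj_apply hg x⟩) (.mk p) rfl
  exact congrArg (fun a => a.unop⁻¹) hdeck

theorem exists_loop_eq (hp : IsQuotientCoveringMap (proj Γ) Γ) {x : H3}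
    (γ : FundamentalGroup (HypQuotient Γ) (proj Γ x)) :
    ∃ (g : Equiv.Perm H3) (hg : g ∈ Γ) (p : Path x (g x)), loop hg p = γ := by
  refine ⟨_, ((deckEquiv hp x γ)⁻¹).2, PathConnectedSpace.somePath _ _,
    (deckEquiv hp x).injective ?_⟩
  rw [deckEquiv_loop]
  exact inv_inv _

theorem map_deckEquiv_coverPi1 (hp : IsQuotientCoveringMap (proj Γ) Γ)
    (hp' : IsQuotientCoveringMap (proj Γ') Γ') (x : H3) :
    (coverPi1 h x).map (deckEquiv hp x).toMonoidHom = Γ'.subgroupOf Γ := by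
  ext ⟨g, hg⟩
  rw [Subgroup.mem_subgroupOf, coverPi1, MonoidHom.map_range]
  constructor
  · rintro ⟨δ, hδ⟩
    obtain ⟨a, ha, p, rfl⟩ := exists_loop_eq hp' δ
    have hag : deckEquiv hp x (loop (h ha) p) = ⟨g, hg⟩ := by rwa [← mapOfEq_coverMap_loop h]
    rw [deckEquiv_loop] at hag
    exact hag ▸ inv_mem ha
  · intro hg'
    refine ⟨loop (inv_mem hg') (PathConnectedSpace.somePath _ _), ?_⟩
    refine (congrArg _ (mapOfEq_coverMap_loop h _ _)).trans ((deckEquiv_loop hp _ _).trans ?_)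
    exact inv_inv _

end Cover

/-! ### Co-final families -/

section Cofinal

variable {G H ι : Type} [Group G] [Group H]

theorem isCofinal_subgroupOf {K : ι → Subgroup G} {L : Subgroup G}
    (hK : ∀ i, (K i).relIndex L ≠ 0) (hinf : ⨅ i, K i = ⊥) :
    IsCofinal fun i => (K i).subgroupOf L := by
  refine ⟨fun i => ⟨hK i⟩, (Subgroup.eq_bot_iff_forall _).2 fun g hg => Subtype.ext ?_⟩
  have hgK : g.1 ∈ ⨅ i, K i := Subgroup.mem_iInf.2 fun i => Subgroup.mem_iInf.1 hg i
  rwa [hinf, Subgroup.mem_bot] at hgK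

theorem IsCofinal.of_map (Φ : G ≃* H) {K : ι → Subgroup G} {K' : ι → Subgroup H}
    (hK : ∀ i, (K i).map Φ.toMonoidHom = K' i) (h : IsCofinal K') : IsCofinal K := by
  refine ⟨fun i => ⟨?_⟩, (Subgroup.eq_bot_iff_forall _).2 fun g hg => ?_⟩
  · rw [← Subgroup.index_map_equiv (K i) Φ]
    exact hK i ▸ (h.1 i).index_ne_zero
  · have hΦg : Φ g ∈ ⨅ i, K' i := Subgroup.mem_iInf.2 fun i =>
      hK i ▸ Subgroup.mem_map_of_mem _ (Subgroup.mem_iInf.1 hg i)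
    rw [h.2, Subgroup.mem_bot] at hΦg
    exact Φ.map_eq_one_iff.1 hΦg

end Cofinal

namespace Construction

theorem isDouble (C : Construction) (m : ℕ) : IsDouble (C.poly m) (C.poly (m + 1)) :=
  ⟨C.mirror m, C.mirror_mem m, C.poly_succ m⟩

theorem reflTransGen_isDouble (C : Construction) (m : ℕ) :
    Relation.ReflTransGen IsDouble (C.poly 0) (C.poly m) := by
  induction m with
  | zero => exact .refl
  | succ m ih => exact ih.tail (C.isDouble m)

theorem monotone_poly_stageStart (C : Construction) :
    Monotone fun i => C.poly (stageStart C.k i) :=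
  (monotone_nat_of_le_succ fun m => (C.isDouble m).subset).comp
    (Finset.sum_mono_set C.k |>.comp Finset.range_mono)

end Construction

end RAPoly

end

open RAPoly in
theorem theorem5p1_general {ι : Type} {P : Set H3} (hP : IsPolyhedron P) (hra : IsRightAngled P)
    {Q : ι → Set H3} (hQ : ∀ p, Relation.ReflTransGen IsDouble P (Q p))
    {stage : ℕ → ι} (hmono : Monotone (Q ∘ stage))
    (habs : ∀ i, ∀ e ∈ faceNormals (Q (stage (i + 1))),
      ¬ HasSubface (Q (stage i)) (Q (stage (i + 1))) e) :
    (⨅ p, reflectionGroup (Q p)) = ⊥ ∧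
    ∀ Γ ≤ reflectionGroup P, ActsFreely Γ →
      IsCofinal (fun p => (reflectionGroup (Q p)).subgroupOf Γ) ∧
      (∀ p, IsCoveringMap (coverMap (inf_le_left : Γ ⊓ reflectionGroup (Q p) ≤ Γ))) ∧
      ∀ x : H3,
        (∃ Φ : FundamentalGroup (HypQuotient Γ) (proj Γ x) ≃* Γ, ∀ p,
          (coverPi1 (inf_le_left : Γ ⊓ reflectionGroup (Q p) ≤ Γ) x).map Φ.toMonoidHom =
            (reflectionGroup (Q p)).subgroupOf Γ) ∧
        IsCofinal (fun p => coverPi1 (inf_le_left : Γ ⊓ reflectionGroup (Q p) ≤ Γ) x) := by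
  obtain ⟨x₀, h⟩ := hP.exists_isChamber hra
  have hbot : ⨅ p, reflectionGroup (Q p) = ⊥ :=
    le_bot_iff.1 <| (le_iInf_comp _ stage).trans
      (h.iInf_reflectionGroup_eq_bot (fun i => hQ (stage i)) hmono habs).le
  refine ⟨hbot, fun Γ hΓ hfree => ?_⟩
  have hcof : IsCofinal fun p => (reflectionGroup (Q p)).subgroupOf Γ :=
    isCofinal_subgroupOf
      (fun p h0 => h.relIndex_ne_zero (hQ p) (Subgroup.relIndex_eq_zero_of_le_right hΓ h0)) hbot
  have hp {Γ' : Subgroup (Equiv.Perm H3)} (hΓ' : Γ' ≤ Γ) : IsQuotientCoveringMap (proj Γ') Γ' :=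
    h.isQuotientCoveringMap_proj (hΓ'.trans hΓ) (hfree.mono hΓ')
  refine ⟨hcof, fun p => isCoveringMap_coverMap _ (hp le_rfl), fun x => ?_⟩
  have hmap p : (coverPi1 (inf_le_left : Γ ⊓ reflectionGroup (Q p) ≤ Γ) x).map
      (deckEquiv (hp le_rfl) x).toMonoidHom = (reflectionGroup (Q p)).subgroupOf Γ := by
    rw [map_deckEquiv_coverPi1 _ _ (hp inf_le_left), Subgroup.inf_subgroupOf_left]
  exact ⟨⟨_, hmap⟩, hcof.of_map _ hmap⟩

open RAPoly in
theorem theorem5p1 (C : Construction) :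
    (⨅ p : C.Idx, C.G p) = ⊥ ∧
    ∀ Γ : Subgroup (Equiv.Perm H3), Γ ≤ C.G ⟨0, 0⟩ → (Γ.subgroupOf (C.G ⟨0, 0⟩)).FiniteIndex →
      ActsFreely Γ →
      IsCofinal (fun p : C.Idx => (C.G p).subgroupOf Γ) ∧
      (∀ p : C.Idx, IsCoveringMap (coverMap (inf_le_left : Γ ⊓ C.G p ≤ Γ))) ∧
      ∀ x : H3,
        (∃ Φ : FundamentalGroup (HypQuotient Γ) (proj Γ x) ≃* Γ, ∀ p : C.Idx,
          (coverPi1 (inf_le_left : Γ ⊓ C.G p ≤ Γ) x).map Φ.toMonoidHom = (C.G p).subgroupOf Γ) ∧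
        IsCofinal (fun p : C.Idx => coverPi1 (inf_le_left : Γ ⊓ C.G p ≤ Γ) x) := by
  obtain ⟨hbot, hcover⟩ := theorem5p1_general C.ideal.isPolyhedron C.rightAngled (Q := C.P)
    (stage := fun i => ⟨i, 0⟩) (fun p => C.reflTransGen_isDouble _) C.monotone_poly_stageStart
    C.absorbed
  exact ⟨hbot, fun Γ hΓ _ hfree => hcover Γ hΓ hfree⟩
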